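/- **Corollary 4.1 (generalized Krylov–Veretennikov formula).** *Setting.* Let $(V,H,V')$ be a normal triple of real Hilbert spaces, $T>0$, and write $\mathcal V(T)=L_2((0,T);V)$, $\mathcal V'(T)=L_2((0,T);V')$. Let $\{\dot W(h): h\in\mathcal U\}$ be a zero-mean Gaussian family on a probability space, indexed by a real separable Hilbert space $\mathcal U$, with $\mathbb E(\dot W(h)\dot W(g))=(h,g)_{\mathcal U}$. Fix an orthonormal basis $(\mathfrak u_k)_{k\in I}$ of $\mathcal U$, $I\subseteq\{1,2,\dots\}$ (with $I=\{1,2,\dots\}$ when $\dim\mathcal U=\infty$). For finitely supported multi-indices $\alpha=(\alpha_k)_{k\in I}$ of non-negative integers put $|\alpha|=\sum_k\alpha_k$, $\alpha!=\prod_k\alpha_k!$, $q^{r\alpha}=\prod_kq_k^{r\alpha_k}$ and $\xi_\alpha=\prod_k H_{\alpha_k}(\dot W(\mathfrak u_k))/\sqrt{\alpha_k!}$, where $H_n$ are the (probabilists') Hermite polynomials; $(0)$ is the zero multi-index, $\varepsilon_k$ the $k$-th unit multi-index, $\xi_k=\xi_{\varepsilon_k}$. *Generalized random elements.* A weight sequence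 is $Q=(q_k)_{k\in I}$ with all $q_k\ge1$. For $r\in\mathbb R$ and a Hilbert space $X$, a formal series $\eta=\sum_\alpha\eta_\alpha\xi_\alpha$, $\eta_\alpha\in X$, belongs to $(\mathcal L)_{Q,r}(X)$ if $\sum_\alpha q^{2r\alpha}\|\eta_\alpha\|_X^2/|\alpha|!<\infty$; a series $\zeta=\sum_\alpha\zeta_\alpha\xi_\alpha$ with real coefficients belongs to the dual $(\mathcal L)^{Q,r}$ if $\sum_\alpha|\alpha|!\,q^{-2r\alpha}\zeta_\alpha^2<\infty$, and then $\langle\!\langle\eta,\zeta\rangle\!\rangle=\sum_\alpha\zeta_\alpha\eta_\alpha\in X$. A random variable $\zeta$ is identified with the series with coefficients $\zeta_\alpha=\mathbb E(\zeta\xi_\alpha)$. For a sequence $f=\sum_kf_k\otimes\mathfrak u_k$ of formal series, $\boldsymbol\delta(f)=\sum_kf_k\diamond\xi_k$, where $\diamond$ is the Wick product $(f\diamond g)_\alpha=\sum_{\beta+\gamma=\alpha}\sqrt{\alpha!/(\beta!\gamma!)}\,g_\gamma f_\beta$. Deterministic linear operators act on formal series coefficient by coefficient. *Operators.* Let $\mathbf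 A(t)$ and $\mathbf M_k(t)$, $k\in I$, be strongly measurable families of bounded linear operators from $V$ to $V'$, each essentially uniformly bounded in $t\in(0,T)$ (the bound may depend on $k$), and $\mathbf M=\sum_k\mathbf M_k\otimes\mathfrak u_k$. Assume: (A) There is a constant $C_{\mathbf A}$ such that for every $s\in[0,T)$, $x_0\in H$ and $F\in L_2((s,T);V')$ the equation $X(t)=x_0+\int_s^t(\mathbf A(r)X(r)+F(r))\,dr$, $s<t\le T$ (as an equality in $L_2((s,T);V')$), has a unique solution $X\in L_2((s,T);V)$, and $\|X\|\le C_{\mathbf A}(\|x_0\|_H+\|F\|)$. The evolution family (semigroup) $\Phi_{t,s}$, $t\ge s\ge 0$, generated by $\mathbf A$ maps $x_0\in H$ to the value at $t$ of the continuous version of the solution with $F=0$. For $F\in\mathcal V'(T)$, $\int_0^t\Phi_{t,s}F(s)\,ds\in\mathcal V(T)$ denotes the extension by continuity of this Bochner integral from $F\in L_2((0,T);H)$ to $F\in\mathcal V'(T)$. (M) There are numbers $C_k\ge0$ such that $\int_0^T\big\|\int_0^t\Phi_{t,s}\mathbf M_k(s)v(s)\,ds\big\|_V^2dt\le C_k^2\|v\|_{\mathcal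 V(T)}^2$ for all $v\in\mathcal V(T)$ and $k\in I$. *Solution.* Let $u^0\in H$ and $f\in\mathcal V'(T)$ be deterministic, and let $u=\sum_\alpha u_\alpha\xi_\alpha$ be the solution of $$u(t)=u^0+\int_0^t\big(\mathbf A(s)u(s)+f(s)+\boldsymbol\delta(\mathbf M(s)u(s))\big)ds .$$ That is, $u\in(\mathcal L)_{Q',r'}(\mathcal V(T))$ for some weight sequence $Q'$ and some $r'\in\mathbb R$, and for every $h\in\mathcal U$ such that $\sum_k(q'_k)^{2\rho}(h,\mathfrak u_k)_{\mathcal U}^2<1$ for some $\rho>0$ and $\mathcal E_h=\exp(\dot W(h)-\frac12\|h\|_{\mathcal U}^2)\in(\mathcal L)^{Q',r'}$, the function $u_h=\langle\!\langle u,\mathcal E_h\rangle\!\rangle$ satisfies $$u_h(t)=u^0+\int_0^t\Big(\mathbf A(s)u_h(s)+f(s)+\sum_k(h,\mathfrak u_k)_{\mathcal U}\mathbf M_k(s)u_h(s)\Big)ds$$ in $\mathcal V'(T)$, where the series over $k$ converges in $\mathcal V'(T)$. *Claim.* Put $q^\circ_k=2k(1+C_k)$ and $\mathbf M^\circ=(q^\circ_k\mathbf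 M_k)_{k\in I}$. Then the recursion $$U_0(t)=u_{(0)}(t),\qquad U_{n+1}(t)=\int_0^t\Phi_{t,s}\,\boldsymbol\delta(\mathbf M^\circ(s)U_n(s))\,ds,\quad n\ge0,$$ determines a unique sequence of formal series $U_n$ with coefficients in $\mathcal V(T)$; all $U_n$ belong to $(\mathcal L)_{Q'',r''}(\mathcal V(T))$ for some common weight sequence $Q''$ and some $r''\in\mathbb R$; and for every $n\ge0$ $$\sum_{|\alpha|=n}(q^\circ)^\alpha u_\alpha(t)\,\xi_\alpha=U_n(t).$$ -/

import Mathlib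

open MeasureTheory ProbabilityTheory Filter Topology
open scoped ENNReal Nat

namespace SkorokhodEvolution

noncomputable section

/-! ### Multi-indices and weights

Multi-indices are finitely supported functions `α : ι →₀ ℕ`, with `|α| = α.degree`. -/

/-- `α! = ∏ₖ αₖ!`. -/
def multiFactorial {ι : Type*} (α : ι →₀ ℕ) : ℝ :=
  α.prod fun _ a => (a ! : ℝ)

/-- `q^{rα} = ∏ₖ qₖ^{r αₖ}`. -/
def weightPow {ι : Type*} (q : ι → ℝ) (r : ℝ) (α : ι →₀ ℕ) : ℝ :=
  α.prod fun k a => q k ^ (r * (a : ℝ))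

/-- A weight sequence: `qₖ ≥ 1` for all `k`. -/
def IsWeightSequence {ι : Type*} (q : ι → ℝ) : Prop :=
  ∀ k, 1 ≤ q k

/-! ### Gaussian white noise, Hermite polynomials, stochastic exponentials -/

/-- `W` is a zero-mean Gaussian family indexed by the Hilbert space `U`, with
`E (W h * W g) = (h, g)_U`. -/
structure IsWhiteNoise {U Ω : Type*} [NormedAddCommGroup U] [InnerProductSpace ℝ U]
    [MeasurableSpace Ω] (P : Measure Ω) (W : U → Ω → ℝ) : Prop where
  gaussian : IsGaussianProcess W P
  mean_zero : ∀ h, ∫ ω, W h ω ∂P = 0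
  covariance : ∀ h g, ∫ ω, W h ω * W g ω ∂P = inner ℝ h g

/-- The Cameron-Martin random variables `ξ_α = ∏ₖ H_{αₖ}(W(𝔲ₖ)) / √(αₖ!)`, with `Hₙ` the
(probabilists') Hermite polynomials. -/
def xi {ι U Ω : Type*} [NormedAddCommGroup U] [InnerProductSpace ℝ U]
    (b : HilbertBasis ι ℝ U) (W : U → Ω → ℝ) (α : ι →₀ ℕ) (ω : Ω) : ℝ :=
  α.prod fun k a => Polynomial.aeval (W (b k) ω) (Polynomial.hermite a) / √(a ! : ℝ)

/-- The stochastic exponential `𝓔_h = exp(W(h) - ‖h‖²/2)`. -/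
def stochExp {U Ω : Type*} [NormedAddCommGroup U] [InnerProductSpace ℝ U]
    (W : U → Ω → ℝ) (h : U) (ω : Ω) : ℝ :=
  Real.exp (W h ω - ‖h‖ ^ 2 / 2)

/-! ### Generalized random elements -/

/-- Formal series `∑_α η_α ξ_α` with coefficients `η_α ∈ X`. -/
abbrev ChaosSeries (ι X : Type*) := (ι →₀ ℕ) → X

/-- The Fourier coefficients `ζ_α = E (ζ ξ_α)` of a random variable `ζ`. -/
def chaosCoeff {ι U Ω : Type*} [NormedAddCommGroup U] [InnerProductSpace ℝ U]
    [MeasurableSpace Ω] (P : Measure Ω) (b : HilbertBasis ι ℝ U) (W : U → Ω → ℝ)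
    (ζ : Ω → ℝ) : ChaosSeries ι ℝ :=
  fun α => ∫ ω, ζ ω * xi b W α ω ∂P

/-- The formal series `∑_α η_α ξ_α` is an element of `(𝓛)_{Q,r}(X)`:
`∑_α q^{2rα} ‖η_α‖² / |α|! < ∞`. -/
def MemChaos {ι X : Type*} [NormedAddCommGroup X] (q : ι → ℝ) (r : ℝ)
    (η : ChaosSeries ι X) : Prop :=
  Summable fun α : ι →₀ ℕ => weightPow q (2 * r) α / (α.degree ! : ℝ) * ‖η α‖ ^ 2

/-- The formal series `∑_α ζ_α ξ_α` is an element of `(𝓛)^{Q,r}`, the dual space of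
`(𝓛)_{Q,r}(ℝ)` relative to the inner product of `L₂(Ω)`. -/
def MemChaosDual {ι : Type*} (q : ι → ℝ) (r : ℝ) (ζ : ChaosSeries ι ℝ) : Prop :=
  Summable fun α : ι →₀ ℕ => (α.degree ! : ℝ) * weightPow q (-(2 * r)) α * ζ α ^ 2

/-- The duality `⟪η, ζ⟫ = ∑_α ζ_α η_α ∈ X` between `(𝓛)_{Q,r}(X)` and `(𝓛)^{Q,r}`. -/
def chaosPairing {ι X : Type*} [NormedAddCommGroup X] [NormedSpace ℝ X]
    (η : ChaosSeries ι X) (ζ : ChaosSeries ι ℝ) : X :=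
  ∑' α, ζ α • η α

/-- `h` is sufficiently small relative to the weight sequence `q`: for some `r > 0`, `h` is in the
domain of `Λ^r`, where `Λ 𝔲ₖ = qₖ 𝔲ₖ`, and `‖Λ^r h‖ < 1`. -/
def SufficientlySmall {ι U : Type*} [NormedAddCommGroup U] [InnerProductSpace ℝ U]
    (b : HilbertBasis ι ℝ U) (q : ι → ℝ) (h : U) : Prop :=
  ∃ r : ℝ, 0 < r ∧ (Summable fun k => (q k ^ r * inner ℝ (b k) h) ^ 2) ∧
    ∑' k, (q k ^ r * inner ℝ (b k) h) ^ 2 < 1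

open Classical in
/-- The Wick product of an `X`-valued and a real formal series. -/
def wick {ι X : Type*} [AddCommGroup X] [Module ℝ X]
    (f : ChaosSeries ι X) (g : ChaosSeries ι ℝ) : ChaosSeries ι X :=
  fun α => ∑ p ∈ Finset.HasAntidiagonal.antidiagonal α,
    √(multiFactorial α / (multiFactorial p.1 * multiFactorial p.2)) • g p.2 • f p.1

open Classical in
/-- The formal series `y ξ_β`. -/
def monomialSeries {ι X : Type*} [Zero X] (β : ι →₀ ℕ) (y : X) : ChaosSeries ι X :=
  fun α => if α = β then y else 0

/-- The series `ξₖ = W(𝔲ₖ)`, that is, `ξ_{εₖ}`. -/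
def xiSeries {ι : Type*} (k : ι) : ChaosSeries ι ℝ :=
  monomialSeries (Finsupp.single k 1) 1

/-- The Skorokhod integral `δ(f) = ∑ₖ fₖ ⋄ ξₖ` of `f = ∑ₖ fₖ ⊗ 𝔲ₖ`. For every multi-index `α`, only
the `k` in the support of `α` contribute. -/
def skorokhod {ι X : Type*} [AddCommGroup X] [Module ℝ X]
    (f : ι → ChaosSeries ι X) : ChaosSeries ι X :=
  fun α => ∑ᶠ k, wick (f k) (xiSeries k) α

/-! ### Normal triples and deterministic evolution equations -/

/-- A normal triple `(V, H, V')` of Hilbert spaces. -/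
structure NormalTriple (V H V' : Type*) [NormedAddCommGroup V] [InnerProductSpace ℝ V]
    [NormedAddCommGroup H] [InnerProductSpace ℝ H]
    [NormedAddCommGroup V'] [InnerProductSpace ℝ V'] where
  /-- the embedding of `V` into `H` -/
  incl : V →L[ℝ] H
  /-- the embedding of `H` into `V'` -/
  incl' : H →L[ℝ] V'
  incl_injective : Function.Injective incl
  incl'_injective : Function.Injective incl'
  incl_dense : DenseRange incl
  incl'_dense : DenseRange incl'
  /-- `V'` is the dual of `V` relative to the inner product in `H` -/
  duality : V' ≃L[ℝ] StrongDual ℝ V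
  duality_incl' : ∀ (f : H) (v : V), duality (incl' f) v = inner ℝ f (incl v)
  bound : ∃ C : ℝ, 0 < C ∧ ∀ (f : H) (v : V), |inner ℝ f (incl v)| ≤ C * ‖v‖ * ‖incl' f‖

/-- `L₂((s, T); X)`. -/
abbrev L2Time (s T : ℝ) (X : Type*) [NormedAddCommGroup X] :=
  Lp X 2 (volume.restrict (Set.Ioc s T))

/-- A family `t ↦ B(t)`, `0 < t ≤ T`, of bounded linear operators that is strongly measurable and
essentially uniformly bounded in `t`, so that it acts from `L₂((0, T); V)` to `L₂((0, T); V')`. -/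
structure OperatorFamily (T : ℝ) (V V' : Type*) [NormedAddCommGroup V] [NormedSpace ℝ V]
    [NormedAddCommGroup V'] [NormedSpace ℝ V'] where
  /-- the operator at time `t` -/
  op : ℝ → V →L[ℝ] V'
  measurable : ∀ v, AEStronglyMeasurable (fun t => op t v) (volume.restrict (Set.Ioc 0 T))
  bounded : ∃ K : ℝ, ∀ᵐ t ∂(volume.restrict (Set.Ioc 0 T)), ‖op t‖ ≤ K

theorem OperatorFamily.aestronglyMeasurable_apply {T : ℝ} {V V' : Type*}
    [NormedAddCommGroup V] [NormedSpace ℝ V] [NormedAddCommGroup V'] [NormedSpace ℝ V']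
    (B : OperatorFamily T V V') {v : ℝ → V}
    (hv : AEStronglyMeasurable v (volume.restrict (Set.Ioc 0 T))) :
    AEStronglyMeasurable (fun t => B.op t (v t)) (volume.restrict (Set.Ioc 0 T)) := by
  obtain ⟨w, hw, hvw⟩ := hv
  have key : AEStronglyMeasurable (fun t => B.op t (w t)) (volume.restrict (Set.Ioc 0 T)) := by
    refine aestronglyMeasurable_of_tendsto_ae (u := atTop)
      (f := fun n t => B.op t (hw.approx n t)) (fun n => ?_) ?_
    · have hsum : (fun t => B.op t (hw.approx n t)) = fun t =>
          ∑ y ∈ (hw.approx n).range,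
            Set.indicator ((hw.approx n) ⁻¹' {y}) (fun t => B.op t y) t := by
        funext t
        rw [Finset.sum_eq_single (hw.approx n t)]
        · simp
        · intro y _ hy
          rw [Set.indicator_of_notMem]
          simpa using hy.symm
        · intro h
          exact absurd (SimpleFunc.mem_range_self _ t) h
      rw [hsum]
      exact Finset.aestronglyMeasurable_fun_sum _ fun y _ =>
        (B.measurable y).indicator ((hw.approx n).measurableSet_fiber y)
    · exact Eventually.of_forall fun t =>
        ((B.op t).continuous.tendsto _).comp (hw.tendsto_approx t)
  exact key.congr (hvw.mono fun t ht => by simp only [ht])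

theorem OperatorFamily.memLp_apply {T : ℝ} {V V' : Type*}
    [NormedAddCommGroup V] [NormedSpace ℝ V] [NormedAddCommGroup V'] [NormedSpace ℝ V']
    (B : OperatorFamily T V V') (v : L2Time 0 T V) :
    MemLp (fun t => B.op t (v t)) 2 (volume.restrict (Set.Ioc 0 T)) := by
  obtain ⟨K, hK⟩ := B.bounded
  refine MemLp.of_le_mul (c := K) (Lp.memLp v)
    (B.aestronglyMeasurable_apply (Lp.aestronglyMeasurable v)) ?_
  filter_upwards [hK] with t ht
  exact (B.op t).le_of_opNorm_le ht _

/-- The function `t ↦ B(t) v(t)`, as an element of `L₂((0, T); V')`. -/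
def OperatorFamily.apply {T : ℝ} {V V' : Type*}
    [NormedAddCommGroup V] [NormedSpace ℝ V] [NormedAddCommGroup V'] [NormedSpace ℝ V']
    (B : OperatorFamily T V V') (v : L2Time 0 T V) : L2Time 0 T V' :=
  (B.memLp_apply v).toLp _

section Evolution

variable {V H V' : Type*} [NormedAddCommGroup V] [InnerProductSpace ℝ V]
  [NormedAddCommGroup H] [InnerProductSpace ℝ H]
  [NormedAddCommGroup V'] [InnerProductSpace ℝ V']

/-- `X ∈ L₂((s, T); V)` solves `X(t) = x₀ + ∫ₛᵗ (A(r) X(r) + F(r)) dr` in `L₂((s, T); V')`. -/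
def IsDetSolution (N : NormalTriple V H V') {T : ℝ} (A : OperatorFamily T V V') (s : ℝ)
    (x₀ : H) (F : L2Time s T V') (X : L2Time s T V) : Prop :=
  ∀ᵐ t ∂(volume.restrict (Set.Ioc s T)),
    N.incl' (N.incl (X t)) = N.incl' x₀ + ∫ r in s..t, (A.op r (X r) + F r)

/-- The deterministic equation is well posed: from every initial time `s ∈ [0, T)` there is a unique
solution, with a bound that is uniform in `s` and in the data. -/
def WellPosed (N : NormalTriple V H V') {T : ℝ} (A : OperatorFamily T V V') : Prop :=
  ∃ C : ℝ, ∀ s ∈ Set.Ico 0 T, ∀ (x₀ : H) (F : L2Time s T V'),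
    ∃ X : L2Time s T V, IsDetSolution N A s x₀ F X ∧
      (∀ Y : L2Time s T V, IsDetSolution N A s x₀ F Y → Y = X) ∧
      ‖X‖ ≤ C * (‖x₀‖ + ‖F‖)

open Classical in
/-- The semigroup (evolution family) `Φ_{t,s}` generated by `A`, for `t ≥ s`: if `X` is the solution of
`X(t) = x + ∫ₛᵗ A(r) X(r) dr` then `Φ_{t,s} x` is the value at `t` of its continuous version, seen as
an element of `V' ⊇ H`. -/
def evolutionFamily (N : NormalTriple V H V') {T : ℝ} (A : OperatorFamily T V V')
    (t s : ℝ) (x : H) : V' :=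
  if h : ∃ X : L2Time s T V, IsDetSolution N A s x 0 X then
    N.incl' x + ∫ r in s..t, A.op r (h.choose r)
  else 0

/-- `G(t) = ∫₀ᵗ Φ_{t,s} F(s) ds` in `L₂((0, T); V)`, for `F ∈ L₂((0, T); V')`. If `F` takes values in
`H`, the right-hand side is a Bochner integral. The values of a general `F` are not in the domain
of `Φ_{t,s}`, and the integral is the extension by continuity from the dense subspace
`L₂((0, T); H)` of `L₂((0, T); V')`. -/
def IsEvolutionIntegral (N : NormalTriple V H V') {T : ℝ} (A : OperatorFamily T V V')
    (F : L2Time 0 T V') (G : L2Time 0 T V) : Prop :=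
  ∃ (Fn : ℕ → L2Time 0 T H) (Gn : ℕ → L2Time 0 T V),
    (∀ n, ∀ᵐ t ∂(volume.restrict (Set.Ioc 0 T)),
      N.incl' (N.incl (Gn n t)) = ∫ s in (0 : ℝ)..t, evolutionFamily N A t s (Fn n s)) ∧
    Tendsto (fun n => N.incl'.compLp (Fn n)) atTop (𝓝 F) ∧
    Tendsto Gn atTop (𝓝 G)

/-! ### The stochastic equation -/

variable {ι U Ω : Type*} [NormedAddCommGroup U] [InnerProductSpace ℝ U] [MeasurableSpace Ω]

/-- `u` is a solution of `u(t) = u⁰ + ∫₀ᵗ (A(s) u(s) + f(s) + δ(M(s) u(s))) ds` with deterministic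
`u⁰`, `f`: it is in some `(𝓛)_{Q,r}(L₂((0, T); V))` and, for every `h` that is sufficiently small
relative to `Q` (and for which the duality with `𝓔_h` is defined), `u_h = ⟪u, 𝓔_h⟫` satisfies
`u_h(t) = u⁰ + ∫₀ᵗ (A(s) u_h(s) + f(s) + (M(s) u_h(s), h)_U) ds`. Here `M = ∑ₖ Mₖ ⊗ 𝔲ₖ`, so that
`(M u_h, h)_U = ∑ₖ (𝔲ₖ, h)_U Mₖ u_h`, a convergent series in `L₂((0, T); V')`. -/
def IsStochSolution (P : Measure Ω) (b : HilbertBasis ι ℝ U) (W : U → Ω → ℝ)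
    (N : NormalTriple V H V') {T : ℝ} (A : OperatorFamily T V V') (M : ι → OperatorFamily T V V')
    (u₀ : H) (f : L2Time 0 T V') (u : ChaosSeries ι (L2Time 0 T V)) : Prop :=
  ∃ (q : ι → ℝ) (r : ℝ), IsWeightSequence q ∧ MemChaos q r u ∧
    ∀ h : U, SufficientlySmall b q h → MemChaosDual q r (chaosCoeff P b W (stochExp W h)) →
      ∃ G : L2Time 0 T V',
        HasSum (fun k => (inner ℝ (b k) h : ℝ) •
          (M k).apply (chaosPairing u (chaosCoeff P b W (stochExp W h)))) G ∧
        IsDetSolution N A 0 u₀ (f + G) (chaosPairing u (chaosCoeff P b W (stochExp W h)))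

/-- The recursion `𝒰₀ = u_{(0)}`, `𝒰ₙ₊₁(t) = ∫₀ᵗ Φ_{t,s} δ(M°(s) 𝒰ₙ(s)) ds`, `M° = (qₖ Mₖ)ₖ`, for
formal series `𝒰ₙ`. Deterministic linear operations act on series coefficient by coefficient. -/
def IsWickIteration (N : NormalTriple V H V') {T : ℝ} (A : OperatorFamily T V V')
    (M : ι → OperatorFamily T V V') (q : ι → ℝ) (v : L2Time 0 T V)
    (𝒰 : ℕ → ChaosSeries ι (L2Time 0 T V)) : Prop :=
  𝒰 0 = monomialSeries 0 v ∧
    ∀ n α, IsEvolutionIntegral N A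
      (skorokhod (fun k β => q k • (M k).apply (𝒰 n β)) α) (𝒰 (n + 1) α)

end Evolution

/-- The formal series `∑_{|α| = n} q^α u_α ξ_α`. -/
def weightedChaosPart {ι X : Type*} [AddCommGroup X] [Module ℝ X] (q : ι → ℝ) (n : ℕ)
    (u : ChaosSeries ι X) : ChaosSeries ι X :=
  fun α => if α.degree = n then weightPow q 1 α • u α else 0

end

end SkorokhodEvolution

open SkorokhodEvolution

/-! It suffices to test the equation with finite combinations `h = ∑ z_k 𝔲_k` with small `z`. The
stochastic exponential of such an `h` has coefficients `z^α / √α!`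
(`IsWhiteNoise.chaosCoeff_stochExp`), so `u_h = ∑ z^α u_α / √α!` is a power series in finitely many
variables. Let `R F` be the deterministic solution with zero initial value and forcing `F`. By
well-posedness the equation reads `u_h = x + ∑ z_k R (M_k u_h)`, where `x` solves the deterministic
problem with data `u⁰, f`. Comparing coefficients of `z^α` (`coeff_eq_of_forall_hasSum`) gives the
propagator `u_α = ∑ √α_k R (M_k u_{α - ε_k})` for `α ≠ 0` (`IsStochSolution.coeff_eq`).

The Skorokhod integral of `g` has coefficients `∑ √α_k g_k(α - ε_k)` (`skorokhod_apply`), and `q^α =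
q_k q^{α - ε_k}`. Multiplying the propagator by `q^α` and sorting by `|α|` therefore gives the
stated recursion, with `R` in the place of the evolution integral (`weightedChaosPart_succ_eq`).

The analytic point is that `R` is the evolution integral (`isEvolutionIntegral_iff`). For forcing
with values in `H` this is Duhamel's formula (`ae_eq_integral_evolutionFamily`), obtained by
integrating over `s` the solutions started at time `s`; density and continuity of `R` give the rest.
The evolution integral thus always exists and is single-valued, so the recursion has exactly one
solution. A weight large enough to absorb `q^α` places all the chaos parts of `u` in one space
(`MemChaos.weightedChaosPart`). -/

namespace SkorokhodEvolution

/-! ### Gaussian integrals of Hermite polynomials and the chaos coefficients of stochastic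
exponentials. -/

section Gaussian

theorem integrable_aeval_mul_exp_gaussianReal (p : Polynomial ℤ) (z : ℝ) :
    Integrable (fun x : ℝ => Polynomial.aeval x p * Real.exp (z * x)) (gaussianReal 0 1) := by
  simp only [Polynomial.aeval_eq_sum_range, Finset.sum_mul]
  refine integrable_finsetSum _ fun i _ => ?_
  have h := integrable_pow_mul_exp_of_mem_interior_integrableExpSet (X := id)
    (μ := gaussianReal 0 1) (v := z)
    (by simp) i
  simpa [zsmul_eq_mul, mul_assoc] using h.const_mul ((p.coeff i : ℝ))

theorem integrable_gaussianReal_iff {g : ℝ → ℝ} :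
    Integrable g (gaussianReal 0 1) ↔ Integrable fun x => gaussianPDFReal 0 1 x * g x := by
  rw [gaussianReal_of_var_ne_zero _ one_ne_zero,
    integrable_withDensity_iff_integrable_smul' (by fun_prop)
      (Eventually.of_forall fun _ => gaussianPDF_lt_top)]
  simp

/-- With `φ` the Gaussian density, `φ' = -xφ` and `H_{n+1} = x H_n - H_n'` make the derivative of `φ
H_n e^{zx}` equal to `φ (z H_n - H_{n+1}) e^{zx}`. A derivative of this kind integrates to zero, so
each step in `n` contributes a factor `z`. -/
theorem integral_aeval_hermite_mul_exp (n : ℕ) (z : ℝ) :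
    ∫ x, Polynomial.aeval x (Polynomial.hermite n) * Real.exp (z * x) ∂gaussianReal 0 1
      = z ^ n * Real.exp (z ^ 2 / 2) := by
  induction n with
  | zero =>
    have := mgf_gaussianReal (X := id) (p := gaussianReal 0 1) (μ := 0) (v := 1) (by simp) z
    simpa [mgf] using this
  | succ n ih =>
    have hderiv : ∀ x, HasDerivAt
        (fun x => gaussianPDFReal 0 1 x *
          (Polynomial.aeval x (Polynomial.hermite n) * Real.exp (z * x)))
        (gaussianPDFReal 0 1 x * (z * (Polynomial.aeval x (Polynomial.hermite n) * Real.exp (z * x))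
          - Polynomial.aeval x (Polynomial.hermite (n + 1)) * Real.exp (z * x))) x := by
      intro x
      have h1 : HasDerivAt (gaussianPDFReal 0 1) (-x * gaussianPDFReal 0 1 x) x := by
        have : HasDerivAt (fun y : ℝ => -(y - 0) ^ 2 / (2 * ((1 : NNReal) : ℝ))) (-x) x := by
          convert! (((hasDerivAt_id x).sub_const (0 : ℝ)).pow 2).neg.div_const
            (2 * ((1 : NNReal) : ℝ)) using 1
          simp
          ring
        convert! (this.exp).const_mul (√(2 * Real.pi * ((1 : NNReal) : ℝ)))⁻¹ using 1
        simp only [gaussianPDFReal]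
        ring
      have h2 := Polynomial.hasDerivAt_aeval (Polynomial.hermite n) x
      have h3 : HasDerivAt (fun x : ℝ => Real.exp (z * x)) (Real.exp (z * x) * z) x := by
        simpa using ((hasDerivAt_id x).const_mul z).exp
      convert! h1.mul (h2.mul h3) using 1
      rw [Polynomial.hermite_succ]
      simp only [map_sub, map_mul, Polynomial.aeval_X, Pi.mul_apply]
      ring
    have hI := integrable_aeval_mul_exp_gaussianReal (Polynomial.hermite n) z
    have hI' := integrable_aeval_mul_exp_gaussianReal (Polynomial.hermite (n + 1)) z
    have h0 := integral_eq_zero_of_hasDerivAt_of_integrable hderiv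
      (integrable_gaussianReal_iff.1 ((hI.const_mul z).sub hI'))
      (integrable_gaussianReal_iff.1 hI)
    simp only [← smul_eq_mul (gaussianPDFReal 0 1 _)] at h0
    rw [← integral_gaussianReal_eq_integral_smul one_ne_zero, integral_sub (hI.const_mul z) hI',
      integral_const_mul, ih] at h0
    linear_combination -h0

variable {ι U Ω : Type*} [NormedAddCommGroup U] [InnerProductSpace ℝ U] [MeasurableSpace Ω]
  {P : Measure Ω} {W : U → Ω → ℝ}

theorem IsWhiteNoise.memLp (hW : IsWhiteNoise P W) (h : U) : MemLp (W h) 2 P :=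
  (hW.gaussian.hasGaussianLaw_eval h).memLp_two

theorem IsWhiteNoise.integrable_mul (hW : IsWhiteNoise P W) (h g : U) :
    Integrable (fun ω => W h ω * W g ω) P :=
  (hW.memLp h).integrable_mul (hW.memLp g)

/-- Linearity is not part of the definition of the noise; it follows from the covariance, because
the second moment of the defect expands to zero by bilinearity of the inner product. -/
theorem IsWhiteNoise.add_smul (hW : IsWhiteNoise P W) (x y : U) (c : ℝ) :
    W (x + c • y) =ᵐ[P] fun ω => W x ω + c * W y ω := by
  have hexp : (fun ω => (W (x + c • y) ω - (W x ω + c * W y ω)) ^ 2) = fun ω =>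
      W (x + c • y) ω * W (x + c • y) ω + W x ω * W x ω + c ^ 2 * (W y ω * W y ω)
      + (-2) * (W (x + c • y) ω * W x ω) + (-2 * c) * (W (x + c • y) ω * W y ω)
      + (2 * c) * (W x ω * W y ω) := by
    funext ω; ring
  have hi := hW.integrable_mul
  have h0 : ∫ ω, (W (x + c • y) ω - (W x ω + c * W y ω)) ^ 2 ∂P = 0 := by
    rw [hexp]
    rw [integral_add (by fun_prop) (by fun_prop), integral_add (by fun_prop) (by fun_prop),
      integral_add (by fun_prop) (by fun_prop), integral_add (by fun_prop) (by fun_prop),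
      integral_add (by fun_prop) (by fun_prop)]
    simp only [integral_const_mul, hW.covariance, inner_add_left, inner_add_right,
      real_inner_smul_left, real_inner_smul_right, real_inner_comm y x]
    ring
  have hint : Integrable (fun ω => (W (x + c • y) ω - (W x ω + c * W y ω)) ^ 2) P := by
    rw [hexp]; fun_prop
  rw [integral_eq_zero_iff_of_nonneg (fun _ => sq_nonneg _) hint] at h0
  filter_upwards [h0] with ω hω
  have : W (x + c • y) ω - (W x ω + c * W y ω) = 0 := by simpa using hω
  linarith

theorem IsWhiteNoise.sum_smul (hW : IsWhiteNoise P W) (K : Finset ι) (z : ι → ℝ) (e : ι → U) :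
    W (∑ k ∈ K, z k • e k) =ᵐ[P] fun ω => ∑ k ∈ K, z k * W (e k) ω := by
  classical
  induction K using Finset.induction_on with
  | empty =>
    -- The choice `x = y = 0`, `c = -1` makes the right-hand side cancel, giving `W 0 = 0` almost
    -- surely.
    filter_upwards [hW.add_smul (0 : U) 0 (-1)] with ω hω
    simpa using hω
  | insert a s ha ih =>
    simp only [Finset.sum_insert ha]
    filter_upwards [hW.add_smul (∑ k ∈ s, z k • e k) (e a) (z a), ih] with ω h1 h2
    rw [add_comm, h1, h2, add_comm]

theorem IsWhiteNoise.map_eq (hW : IsWhiteNoise P W) {h : U} (hh : ‖h‖ = 1) :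
    P.map (W h) = gaussianReal 0 1 := by
  rw [(hW.gaussian.hasGaussianLaw_eval h).map_eq_gaussianReal, hW.mean_zero,
    variance_of_integral_eq_zero (hW.gaussian.aemeasurable h) (hW.mean_zero h)]
  have := hW.covariance h h
  simp only [← sq, real_inner_self_eq_norm_sq, hh] at this
  simp [this]

/-- Jointly Gaussian variables that are uncorrelated are independent. -/
theorem IsWhiteNoise.iIndepFun_orthonormal (hW : IsWhiteNoise P W) {e : ι → U}
    (he : Orthonormal ℝ e) (K : Finset ι) : iIndepFun (fun k : K => W (e k)) P := by
  classical
  have := hW.gaussian.isProbabilityMeasure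
  have hg : IsGaussianProcess (fun k : ι => W (e k)) P := hW.gaussian.comp_right e
  refine (hg.hasGaussianLaw K).iIndepFun_of_covariance_eq_zero fun i j hij => ?_
  change cov[W (e i), W (e j); P] = 0
  rw [covariance_eq_sub (hW.memLp _) (hW.memLp _)]
  simp only [Pi.mul_apply]
  rw [hW.covariance, hW.mean_zero, he.2 (fun h => hij (Subtype.ext h))]
  simp

/-- The Fourier coefficients of the stochastic exponential. -/
theorem IsWhiteNoise.chaosCoeff_stochExp (hW : IsWhiteNoise P W) (b : HilbertBasis ι ℝ U)
    (z : ι →₀ ℝ) (α : ι →₀ ℕ) :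
    chaosCoeff P b W (stochExp W (z.sum fun k c => c • b k)) α
      = α.prod fun k a => z k ^ a / √(a ! : ℝ) := by
  classical
  have := hW.gaussian.isProbabilityMeasure
  -- Both the exponential and `ξ_α` factor over the same finite set `K`, so independence reduces the
  -- expectation to one-dimensional integrals. In each of them `exp(-z²/2)` cancels the `exp(z²/2)`
  -- produced by the Hermite integral.
  set K := z.support ∪ α.support with hK
  have hsum : (z.sum fun k c => c • b k) = ∑ k ∈ K, z k • b k :=
    Finsupp.sum_of_support_subset _ Finset.subset_union_left _ (by simp)
  have hnorm : ‖∑ k ∈ K, z k • b k‖ ^ 2 = ∑ k ∈ K, z k ^ 2 := by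
    rw [← real_inner_self_eq_norm_sq, b.orthonormal.inner_sum]
    simp [sq]
  rw [hsum, chaosCoeff]
  have hae : (fun ω => stochExp W (∑ k ∈ K, z k • b k) ω * xi b W α ω) =ᵐ[P]
      fun ω => ∏ k : K, (Polynomial.aeval (W (b k) ω) (Polynomial.hermite (α k))
        * Real.exp (z k * W (b k) ω)) * (Real.exp (-(z k ^ 2 / 2)) / √((α k) ! : ℝ)) := by
    filter_upwards [hW.sum_smul K z b] with ω hω
    rw [Finset.prod_coe_sort K fun k => (Polynomial.aeval (W (b k) ω) (Polynomial.hermite (α k))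
        * Real.exp (z k * W (b k) ω)) * (Real.exp (-(z k ^ 2 / 2)) / √((α k) ! : ℝ))]
    rw [stochExp, hω, hnorm, xi, Finsupp.prod_of_support_subset _ Finset.subset_union_right _
      (by simp [Polynomial.hermite_zero]), Finset.sum_div, ← Finset.sum_sub_distrib, Real.exp_sum,
      ← Finset.prod_mul_distrib]
    refine Finset.prod_congr rfl fun k _ => ?_
    rw [sub_eq_add_neg, Real.exp_add]
    ring
  rw [integral_congr_ae hae]
  have hcont : ∀ k : K, Continuous fun x : ℝ => (Polynomial.aeval x (Polynomial.hermite (α k))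
        * Real.exp (z k * x)) * (Real.exp (-(z k ^ 2 / 2)) / √((α k) ! : ℝ)) := fun k => by
    have := Polynomial.continuous_aeval (A := ℝ) (Polynomial.hermite (α k))
    fun_prop
  have hprod := (hW.iIndepFun_orthonormal b.orthonormal K).integral_fun_prod_comp
    (f := fun (k : K) x => (Polynomial.aeval x (Polynomial.hermite (α k))
        * Real.exp (z k * x)) * (Real.exp (-(z k ^ 2 / 2)) / √((α k) ! : ℝ)))
    (fun k => hW.gaussian.aemeasurable _) (fun k => (hcont k).aestronglyMeasurable)
  rw [hprod, Finsupp.prod_of_support_subset α Finset.subset_union_right _ (by simp),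
    ← hK, ← Finset.prod_coe_sort K]
  refine Finset.prod_congr rfl fun k _ => ?_
  rw [← integral_map (hW.gaussian.aemeasurable (b k))
    (f := fun x => (Polynomial.aeval x (Polynomial.hermite (α k))
        * Real.exp (z k * x)) * (Real.exp (-(z k ^ 2 / 2)) / √((α k) ! : ℝ)))
    (hcont k).aestronglyMeasurable, hW.map_eq (b.orthonormal.1 k), integral_mul_const,
    integral_aeval_hermite_mul_exp, mul_assoc, ← mul_div_assoc, ← Real.exp_add]
  simp [div_eq_mul_inv]

end Gaussian

/-! ### Uniqueness of coefficients of vector-valued power series. -/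

section PowerSeries

variable {ι X : Type*} [NormedAddCommGroup X] [NormedSpace ℝ X]

/-- A vector-valued power series in one variable with sum zero near the origin vanishes. -/
theorem eq_zero_of_eventually_hasSum_pow_smul {c : ℕ → X}
    (h : ∀ᶠ t : ℝ in 𝓝 0, HasSum (fun n => t ^ n • c n) 0) (n : ℕ) : c n = 0 := by
  let p : FormalMultilinearSeries ℝ ℝ X := fun n => ContinuousMultilinearMap.mkPiRing ℝ (Fin n) (c n)
  have hc : ∀ n, p.coeff n = c n := fun n => by
    simp [p, FormalMultilinearSeries.coeff]
  have hp : HasFPowerSeriesAt (0 : ℝ → X) p 0 := by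
    rw [hasFPowerSeriesAt_iff]
    simpa [hc] using h
  rw [← hc, hp.eq_zero]
  simp [FormalMultilinearSeries.coeff]

theorem prod_pow_eq_zero_of_not_subset {J : Finset ι} {z : ι →₀ ℝ} (hz : z.support ⊆ J)
    {α : ι →₀ ℕ} (hα : ¬ α.support ⊆ J) : (α.prod fun k a => z k ^ a) = 0 := by
  obtain ⟨k, hk, hkJ⟩ := Finset.not_subset.1 hα
  refine Finset.prod_eq_zero hk ?_
  have : z k = 0 := by
    by_contra hne
    exact hkJ (hz (Finsupp.mem_support_iff.2 hne))
  simp only [this]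
  exact zero_pow (Finsupp.mem_support_iff.1 hk)

/-- The sum of a function supported on multi-indices in `J` over the multi-indices of degree `n`. -/
theorem hasSum_degree_fiber {ι E : Type*} [AddCommMonoid E] [TopologicalSpace E]
    [DecidableEq ι] {J : Finset ι} {g : (ι →₀ ℕ) → E}
    (hg : ∀ β : ι →₀ ℕ, ¬ β.support ⊆ J → g β = 0) (n : ℕ) :
    HasSum (fun β : {β : ι →₀ ℕ // β.degree = n} => g β) (∑ α ∈ J.finsuppAntidiag n, g α) := by
  refine (hasSum_subtype_iff_indicator (s := {β : ι →₀ ℕ | β.degree = n})).2 ?_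
  have hind : ∑ α ∈ J.finsuppAntidiag n, g α =
      ∑ α ∈ J.finsuppAntidiag n, Set.indicator {β : ι →₀ ℕ | β.degree = n} g α := by
    refine Finset.sum_congr rfl fun β hβ => ?_
    rw [Set.indicator_of_mem]
    obtain ⟨h1, h2⟩ := Finset.mem_finsuppAntidiag.1 hβ
    rw [Set.mem_ofPred_eq, Finsupp.degree_apply, ← h1]
    exact Finset.sum_subset h2 (by simp)
  rw [hind]
  refine hasSum_sum_of_ne_finset_zero fun β hβ => ?_
  by_cases hdeg : β.degree = n
  · rw [Set.indicator_of_mem (by exact hdeg), hg]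
    intro hsub
    refine hβ (Finset.mem_finsuppAntidiag.2 ⟨?_, hsub⟩)
    rw [← hdeg, Finsupp.degree_apply]
    exact (Finset.sum_subset hsub (by simp)).symm
  · exact Set.indicator_of_notMem (s := {β : ι →₀ ℕ | β.degree = n}) hdeg _

open Classical in
/-- A homogeneous vector-valued polynomial that vanishes near the origin has zero coefficients. -/
theorem eq_zero_of_sum_finsuppAntidiag_eq_zero {d : (ι →₀ ℕ) → X} {J : Finset ι} {ε : ℝ}
    (hε : 0 < ε) {n : ℕ}
    (h : ∀ z : ι →₀ ℝ, z.support ⊆ J → (∀ k, |z k| < ε) →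
      ∑ α ∈ J.finsuppAntidiag n, (α.prod fun k a => z k ^ a) • d α = 0)
    {α : ι →₀ ℕ} (hα : α ∈ J.finsuppAntidiag n) : d α = 0 := by
  -- Continuous functionals separate points, which leaves a scalar polynomial; it is zero as soon as
  -- it vanishes on a product of infinite sets.
  refine SeparatingDual.eq_zero_of_forall_dual_eq_zero (R := ℝ) fun g => ?_
  let p : MvPolynomial ι ℝ := ∑ β ∈ J.finsuppAntidiag n, MvPolynomial.monomial β (g (d β))
  have hp : p = 0 := by
    refine MvPolynomial.funext_set (fun _ => Set.Ioo (-ε) ε)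
      (fun _ => Set.Ioo_infinite (by linarith)) fun x hx => ?_
    -- The variables outside `J` may be set to zero, since the monomials of `p` do not contain them.
    let z : ι →₀ ℝ := Finsupp.onFinset J (fun k => if k ∈ J then x k else 0) fun k hk => by
      by_contra hkJ
      simp [hkJ] at hk
    have hz := h z Finsupp.support_onFinset_subset fun k => by
      have := hx k (Set.mem_univ k)
      simp only [z, Finsupp.onFinset_apply]
      split_ifs
      · exact abs_lt.2 this
      · simpa using hε
    rw [map_zero]
    simp only [p, map_sum, MvPolynomial.eval_monomial]
    have := congrArg g hz
    rw [map_zero, map_sum] at this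
    rw [← this]
    refine Finset.sum_congr rfl fun β hβ => ?_
    rw [map_smul, smul_eq_mul, mul_comm]
    congr 1
    refine Finset.prod_congr rfl fun k hk => ?_
    have : k ∈ J := (Finset.mem_finsuppAntidiag.1 hβ).2 hk
    simp [z, this]
  have := congrArg (MvPolynomial.coeff α) hp
  rw [MvPolynomial.coeff_sum] at this
  simpa [MvPolynomial.coeff_monomial, hα] using this

/-- Uniqueness of the coefficients of vector-valued power series in finitely many variables. -/
theorem eq_zero_of_forall_hasSum_prod_pow_smul {d : (ι →₀ ℕ) → X} {J : Finset ι} {ε : ℝ}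
    (hε : 0 < ε)
    (h : ∀ z : ι →₀ ℝ, z.support ⊆ J → (∀ k, |z k| < ε) →
      HasSum (fun α : ι →₀ ℕ => (α.prod fun k a => z k ^ a) • d α) 0)
    {α : ι →₀ ℕ} (hα : α.support ⊆ J) : d α = 0 := by
  classical
  refine eq_zero_of_sum_finsuppAntidiag_eq_zero (J := J) (n := ∑ k ∈ J, α k) hε (fun z hz hzε => ?_)
    (Finset.mem_finsuppAntidiag.2 ⟨rfl, hα⟩)
  -- Along the line `t ↦ t z` the series becomes a power series in `t`, whose `n`-th coefficient is
  -- the homogeneous part of degree `n` at `z`.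
  refine eq_zero_of_eventually_hasSum_pow_smul
    (c := fun n => ∑ α ∈ J.finsuppAntidiag n, (α.prod fun k a => z k ^ a) • d α) ?_ _
  have hball : ∀ᶠ t : ℝ in 𝓝 0, |t| < 1 := by
    filter_upwards [Metric.ball_mem_nhds (0 : ℝ) one_pos] with t ht
    simpa using ht
  filter_upwards [hball] with t ht
  have hs := h (t • z) (Finsupp.support_smul.trans hz) fun k => by
    rw [Finsupp.smul_apply, smul_eq_mul, abs_mul]
    nlinarith [hzε k, abs_nonneg (z k), abs_nonneg t]
  have hterm : ∀ β : ι →₀ ℕ, (β.prod fun k a => (t • z) k ^ a)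
      = t ^ β.degree * β.prod fun k a => z k ^ a := fun β => by
    simp only [Finsupp.prod, Finsupp.smul_apply, smul_eq_mul, mul_pow, Finset.prod_mul_distrib,
      Finset.prod_pow_eq_pow_sum, Finsupp.degree]
    rfl
  have hs' := (Equiv.sigmaFiberEquiv (Finsupp.degree : (ι →₀ ℕ) → ℕ)).hasSum_iff.2 hs
  refine hs'.sigma fun n => ?_
  have key := hasSum_degree_fiber (J := J)
    (g := fun β : ι →₀ ℕ => (β.prod fun k a => (t • z) k ^ a) • d β) (fun β hβ => by
      rw [hterm, prod_pow_eq_zero_of_not_subset hz hβ, mul_zero, zero_smul]) n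
  convert! key using 1
  rw [Finset.smul_sum]
  refine Finset.sum_congr rfl fun β hβ => ?_
  have hdeg : β.degree = n := by
    obtain ⟨h1, h2⟩ := Finset.mem_finsuppAntidiag.1 hβ
    rw [Finsupp.degree_apply, ← h1]
    exact Finset.sum_subset h2 (by simp)
  rw [hterm, hdeg, mul_smul]

end PowerSeries

/-! ### Convergence of the duality pairing, comparison of coefficients, the Skorokhod integral,
weights. -/

section Chaos

variable {ι X : Type*}

theorem multiFactorial_pos (α : ι →₀ ℕ) : 0 < multiFactorial α :=
  Finset.prod_pos fun _ _ => by positivity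

theorem multiFactorial_add_single (γ : ι →₀ ℕ) (k : ι) :
    multiFactorial (γ + Finsupp.single k 1) = (γ k + 1) * multiFactorial γ := by
  classical
  have h0 : ∀ i : ι, (((0 : ℕ) ! : ℕ) : ℝ) = 1 := fun _ => by simp
  rw [multiFactorial, multiFactorial,
    ← Finsupp.mul_prod_erase' (γ + Finsupp.single k 1) k (fun _ a => ((a ! : ℕ) : ℝ)) h0,
    ← Finsupp.mul_prod_erase' γ k (fun _ a => ((a ! : ℕ) : ℝ)) h0]
  have : (γ + Finsupp.single k 1).erase k = γ.erase k := by
    ext i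
    by_cases hi : i = k
    · simp [hi]
    · simp [Finsupp.erase_ne hi]
  rw [this, Finsupp.add_apply, Finsupp.single_eq_same, Nat.factorial_succ]
  push_cast
  ring

theorem sqrt_multiFactorial (α : ι →₀ ℕ) :
    √(multiFactorial α) = α.prod fun _ a => √(a ! : ℝ) :=
  Real.sqrt_prod _ fun _ _ => by positivity

theorem prod_pow_div_sqrt (z : ι → ℝ) (α : ι →₀ ℕ) :
    (α.prod fun k a => z k ^ a / √(a ! : ℝ))
      = (α.prod fun k a => z k ^ a) * (√(multiFactorial α))⁻¹ := by
  rw [sqrt_multiFactorial, ← div_eq_mul_inv]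
  exact Finset.prod_div_distrib (fun k => z k ^ α k) fun k => √((α k) ! : ℝ)

theorem weightPow_pos {q : ι → ℝ} (hq : IsWeightSequence q) (r : ℝ) (α : ι →₀ ℕ) :
    0 < weightPow q r α :=
  Finset.prod_pos fun k _ => Real.rpow_pos_of_pos (one_pos.trans_le (hq k)) _

theorem weightPow_mul_neg {q : ι → ℝ} (hq : IsWeightSequence q) (r : ℝ) (α : ι →₀ ℕ) :
    weightPow q r α * weightPow q (-r) α = 1 := by
  rw [weightPow, weightPow, Finsupp.prod, Finsupp.prod, ← Finset.prod_mul_distrib]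
  refine Finset.prod_eq_one fun k _ => ?_
  have := one_pos.trans_le (hq k)
  rw [← Real.rpow_add this]
  simp

/-- The weights of the two spaces are reciprocal, so each term has norm `a c`, where `a²` and `c²`
are the terms of the two defining series; then `a c ≤ a² + c²`. -/
theorem summable_smul_of_memChaos [NormedAddCommGroup X] [NormedSpace ℝ X] [CompleteSpace X]
    {q : ι → ℝ} (hq : IsWeightSequence q) {r : ℝ} {η : ChaosSeries ι X} {ζ : ChaosSeries ι ℝ}
    (hη : MemChaos q r η) (hζ : MemChaosDual q r ζ) : Summable fun α => ζ α • η α := by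
  refine Summable.of_norm_bounded (hη.add hζ) fun α => ?_
  have hw := weightPow_pos hq (2 * r) α
  have hw' := weightPow_pos hq (-(2 * r)) α
  have hm := weightPow_mul_neg hq (2 * r) α
  set w := weightPow q (2 * r) α
  set w' := weightPow q (-(2 * r)) α
  have hf : (0 : ℝ) < (α.degree ! : ℝ) := by positivity
  rw [norm_smul, Real.norm_eq_abs]
  set a := √(w / (α.degree ! : ℝ)) * ‖η α‖
  set c := √((α.degree ! : ℝ) * w') * |ζ α|
  have ha : a ^ 2 = w / (α.degree ! : ℝ) * ‖η α‖ ^ 2 := by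
    rw [mul_pow, Real.sq_sqrt (by positivity)]
  have hc : c ^ 2 = (α.degree ! : ℝ) * w' * ζ α ^ 2 := by
    rw [mul_pow, Real.sq_sqrt (by positivity), sq_abs]
  have hac : a * c = |ζ α| * ‖η α‖ := by
    have : √(w / (α.degree ! : ℝ)) * √((α.degree ! : ℝ) * w') = 1 := by
      rw [← Real.sqrt_mul (by positivity), Real.sqrt_eq_one]
      field_simp
      exact hm
    calc a * c = (√(w / (α.degree ! : ℝ)) * √((α.degree ! : ℝ) * w')) * (|ζ α| * ‖η α‖) := by
          simp only [a, c]; ring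
      _ = _ := by rw [this, one_mul]
  rw [← ha, ← hc, ← hac]
  nlinarith [sq_nonneg (a - c), sq_nonneg a, sq_nonneg c]

/-- The multinomial series `∑ |α|! / α! y^α` over multi-indices supported in a finite set. -/
theorem summable_multinomial {J : Finset ι} {y : ι → ℝ} (hy : ∀ k, 0 ≤ y k)
    (hyJ : ∀ k ∉ J, y k = 0) (hsum : ∑ k ∈ J, y k < 1) :
    Summable fun α : ι →₀ ℕ =>
      (α.degree ! : ℝ) * ((α.prod fun k a => y k ^ a) / multiFactorial α) := by
  classical
  set g : (ι →₀ ℕ) → ℝ := fun α =>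
    (α.degree ! : ℝ) * ((α.prod fun k a => y k ^ a) / multiFactorial α) with hg
  have hg0 : ∀ α, 0 ≤ g α := fun α => by
    have := multiFactorial_pos α
    have : 0 ≤ α.prod fun k a => y k ^ a := Finset.prod_nonneg fun k _ => pow_nonneg (hy k) _
    positivity
  have hgJ : ∀ α : ι →₀ ℕ, ¬ α.support ⊆ J → g α = 0 := fun α hα => by
    obtain ⟨k, hk, hkJ⟩ := Finset.not_subset.1 hα
    have : (α.prod fun k a => y k ^ a) = 0 := by
      refine Finset.prod_eq_zero hk ?_
      simp only [hyJ k hkJ]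
      exact zero_pow (Finsupp.mem_support_iff.1 hk)
    simp [hg, this]
  have hfib := hasSum_degree_fiber hgJ
  -- By the multinomial theorem the terms of degree `n` add up to an `n`-th power, so the whole
  -- series is geometric.
  have hpow : ∀ n, ∑ α ∈ J.finsuppAntidiag n, g α = (∑ k ∈ J, y k) ^ n := fun n => by
    rw [Finset.sum_pow_eq_sum_piAntidiag]
    refine Finset.sum_nbij (fun α : ι →₀ ℕ => (α : ι → ℕ)) ?_ ?_ ?_ ?_
    · intro α hα
      obtain ⟨h1, h2⟩ := Finset.mem_finsuppAntidiag.1 hα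
      refine Finset.mem_piAntidiag.2 ⟨h1, fun i hi => h2 (Finsupp.mem_support_iff.2 hi)⟩
    · exact fun _ _ _ _ h => DFunLike.coe_injective h
    · intro β hβ
      obtain ⟨h1, h2⟩ := Finset.mem_piAntidiag.1 hβ
      refine ⟨Finsupp.onFinset J β h2, Finset.mem_finsuppAntidiag.2
        ⟨h1, Finsupp.support_onFinset_subset⟩, rfl⟩
    · intro α hα
      obtain ⟨h1, h2⟩ := Finset.mem_finsuppAntidiag.1 hα
      have hdeg : α.degree = ∑ k ∈ J, α k := by
        rw [Finsupp.degree_apply]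
        exact Finset.sum_subset h2 (by simp)
      have hm : ((α.degree ! : ℕ) : ℝ) = multiFactorial α * (Nat.multinomial J α : ℝ) := by
        rw [hdeg, ← Nat.multinomial_spec, multiFactorial,
          Finsupp.prod_of_support_subset _ h2 _ (by simp)]
        push_cast
        rfl
      simp only [hg]
      rw [hm, Finsupp.prod_of_support_subset _ h2 _ (by simp)]
      have := (multiFactorial_pos α).ne'
      field_simp
  rw [← (Equiv.sigmaFiberEquiv (Finsupp.degree : (ι →₀ ℕ) → ℕ)).summable_iff,
    summable_sigma_of_nonneg (f := g ∘ _) (fun _ => hg0 _)]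
  refine ⟨fun n => (hfib n).summable, ?_⟩
  have : (fun n => ∑' β : {β : ι →₀ ℕ // β.degree = n}, g β) = fun n => (∑ k ∈ J, y k) ^ n := by
    funext n
    rw [(hfib n).tsum_eq, hpow]
  change Summable (fun n => ∑' β : {β : ι →₀ ℕ // β.degree = n}, g β)
  rw [this]
  exact summable_geometric_of_lt_one (Finset.sum_nonneg fun k _ => hy k) hsum

/-- For the coefficients `z^α / √α!` the dual norm is the multinomial series in `y_k = q_k^{-2r}
z_k²`. Hence one smallness condition on `z` gives membership in the dual space and also the bound
needed for `SufficientlySmall` with exponent `1`. -/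
theorem exists_pos_forall_memChaosDual {q : ι → ℝ} (hq : IsWeightSequence q) (r : ℝ)
    (J : Finset ι) : ∃ ε : ℝ, 0 < ε ∧ ∀ z : ι →₀ ℝ, z.support ⊆ J → (∀ k, |z k| < ε) →
      ∑ k ∈ J, (q k ^ (1 : ℝ) * z k) ^ 2 < 1 ∧
      MemChaosDual q r fun α => α.prod fun k a => z k ^ a / √(a ! : ℝ) := by
  have hq0 : ∀ k, 0 < q k := fun k => one_pos.trans_le (hq k)
  have hw0 : ∀ k, 0 < q k ^ (-(2 * r)) := fun k => Real.rpow_pos_of_pos (hq0 k) _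
  set S := ∑ k ∈ J, (q k ^ 2 + q k ^ (-(2 * r))) with hS
  have hS0 : 0 ≤ S := Finset.sum_nonneg fun k _ => by have := hw0 k; positivity
  -- This radius bounds the sum of both requirements by `S / (S + 1) < 1`.
  refine ⟨(√(S + 1))⁻¹, by positivity, fun z hz hzε => ?_⟩
  have hz2 : ∀ k, z k ^ 2 ≤ (S + 1)⁻¹ := fun k => by
    rw [← sq_abs, ← Real.sq_sqrt (show 0 ≤ (S + 1)⁻¹ by positivity), Real.sqrt_inv]
    exact pow_le_pow_left₀ (abs_nonneg _) (hzε k).le 2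
  have hlt : ∑ k ∈ J, (q k ^ 2 + q k ^ (-(2 * r))) * z k ^ 2 < 1 := by
    calc ∑ k ∈ J, (q k ^ 2 + q k ^ (-(2 * r))) * z k ^ 2
        ≤ ∑ k ∈ J, (q k ^ 2 + q k ^ (-(2 * r))) * (S + 1)⁻¹ :=
          Finset.sum_le_sum fun k _ => mul_le_mul_of_nonneg_left (hz2 k)
            (by have := hw0 k; positivity)
      _ = S / (S + 1) := by rw [← Finset.sum_mul, ← div_eq_mul_inv]
      _ < 1 := by rw [div_lt_one (by positivity)]; linarith
  constructor
  · refine lt_of_le_of_lt (Finset.sum_le_sum fun k _ => ?_) hlt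
    rw [Real.rpow_one, mul_pow]
    exact mul_le_mul_of_nonneg_right (by linarith [hw0 k]) (sq_nonneg _)
  · have hsum := summable_multinomial (J := J) (y := fun k => q k ^ (-(2 * r)) * z k ^ 2)
      (fun k => mul_nonneg (hw0 k).le (sq_nonneg _))
      (fun k hk => by
        have : z k = 0 := by
          by_contra hne
          exact hk (hz (Finsupp.mem_support_iff.2 hne))
        simp [this])
      (lt_of_le_of_lt (Finset.sum_le_sum fun k _ =>
        mul_le_mul_of_nonneg_right (by nlinarith [hq0 k]) (sq_nonneg _)) hlt)
    refine hsum.congr fun α => ?_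
    dsimp only
    rw [prod_pow_div_sqrt, mul_pow, inv_pow, Real.sq_sqrt (multiFactorial_pos α).le]
    have : (α.prod fun k a => (q k ^ (-(2 * r)) * z k ^ 2) ^ a)
        = weightPow q (-(2 * r)) α * (α.prod fun k a => z k ^ a) ^ 2 := by
      simp only [weightPow, Finsupp.prod, ← Finset.prod_pow, ← Finset.prod_mul_distrib]
      refine Finset.prod_congr rfl fun k _ => ?_
      rw [Real.rpow_mul_natCast (hq0 k).le]
      ring
    rw [this]
    ring

section Recursion

variable [NormedAddCommGroup X] [NormedSpace ℝ X]

/-- The lowering relation satisfied by the coefficients of a solution of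
`Y = x + ∑ₖ zₖ Bₖ Y`, where `Y = ∑_α z^α c_α`. -/
theorem coeff_eq_of_forall_hasSum {c : (ι →₀ ℕ) → X} {x : X} {B : ι → X →L[ℝ] X}
    {J : Finset ι} {ε : ℝ} (hε : 0 < ε)
    (h : ∀ z : ι →₀ ℝ, z.support ⊆ J → (∀ k, |z k| < ε) →
      ∃ Y, HasSum (fun α : ι →₀ ℕ => (α.prod fun k a => z k ^ a) • c α) Y ∧
        Y = x + ∑ k ∈ J, z k • B k Y)
    {α : ι →₀ ℕ} (hα : α.support ⊆ J) :
    c α = monomialSeries 0 x α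
      + ∑ k ∈ α.support, B k (c (α - Finsupp.single k 1)) := by
  classical
  set s : (ι →₀ ℕ) → X := fun β => if β = 0 then x else 0 with hs
  set l : ι → (ι →₀ ℕ) → X := fun k β =>
    if β k = 0 then 0 else B k (c (β - Finsupp.single k 1)) with hl
  have key : c α - (s α + ∑ k ∈ J, l k α) = 0 := by
    -- Here `s` and `l k` are the coefficients of `x` and of `z_k B_k Y`, so the difference series
    -- sums to `Y - (x + ∑ z_k B_k Y) = 0`.
    refine eq_zero_of_forall_hasSum_prod_pow_smul (d := fun β => c β - (s β + ∑ k ∈ J, l k β))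
      hε (fun z hz hzε => ?_) hα
    obtain ⟨Y, hY, hYeq⟩ := h z hz hzε
    have h1 : HasSum (fun β : ι →₀ ℕ => (β.prod fun k a => z k ^ a) • s β) x := by
      convert! hasSum_ite_eq (0 : ι →₀ ℕ) x using 1
      funext β
      by_cases hβ : β = 0 <;> simp [hs, hβ]
    have h2 : ∀ k, HasSum (fun β : ι →₀ ℕ => (β.prod fun k a => z k ^ a) • l k β)
        (z k • B k Y) := fun k => by
      -- Multiplication by `z_k` shifts exponents by `ε_k`; the indices missed by the shift are
      -- those with `β k = 0`, where `l k` vanishes.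
      have hinj : Function.Injective fun γ : ι →₀ ℕ => γ + Finsupp.single k 1 :=
        add_left_injective _
      refine (hinj.hasSum_iff fun β hβ => ?_).1 ?_
      · have : β k = 0 := by
          by_contra hne
          refine hβ ⟨β - Finsupp.single k 1, ?_⟩
          refine tsub_add_cancel_of_le ?_
          rw [Finsupp.single_le_iff]
          exact Nat.one_le_iff_ne_zero.2 hne
        simp [hl, this]
      · convert! ((B k).hasSum hY).const_smul (z k) using 1
        funext γ
        simp only [Function.comp_apply, hl, map_smul, smul_smul]
        rw [if_neg (by simp), add_tsub_cancel_right,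
          Finsupp.prod_add_index' (by simp) (fun _ _ _ => pow_add _ _ _)]
        simp [mul_comm]
    have h3 := hY.sub (h1.add (hasSum_sum (s := J) fun k _ => h2 k))
    rw [← hYeq, sub_self] at h3
    refine h3.congr_fun fun β => ?_
    simp only [smul_sub, smul_add, Finset.smul_sum]
  rw [sub_eq_zero] at key
  rw [key]
  refine congrArg₂ (· + ·) rfl ?_
  rw [← Finset.sum_subset hα fun k _ hk => by simp [hl, Finsupp.notMem_support_iff.1 hk]]
  refine Finset.sum_congr rfl fun k hk => ?_
  simp [hl, Finsupp.mem_support_iff.1 hk]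

end Recursion

/-- The coefficients of the Skorokhod integral. -/
theorem skorokhod_apply [AddCommGroup X] [Module ℝ X] (f : ι → ChaosSeries ι X) (α : ι →₀ ℕ) :
    skorokhod f α = ∑ k ∈ α.support, √(α k : ℝ) • f k (α - Finsupp.single k 1) := by
  classical
  -- Only the splitting `α = (α - ε_k) + ε_k` survives, and its factor is `√(α! / (α - ε_k)!) =
  -- √α_k`.
  have hwick : ∀ k, wick (f k) (xiSeries k) α
      = if α k = 0 then 0 else √(α k : ℝ) • f k (α - Finsupp.single k 1) := fun k => by
    rw [wick]
    split_ifs with hk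
    · refine Finset.sum_eq_zero fun p hp => ?_
      rw [xiSeries, monomialSeries, if_neg, zero_smul, smul_zero]
      rintro hp2
      have := congrArg (fun β : ι →₀ ℕ => β k) (Finset.HasAntidiagonal.mem_antidiagonal.1 hp)
      simp [hp2, hk] at this
    · have hle : Finsupp.single k 1 ≤ α := by
        rw [Finsupp.single_le_iff]
        exact Nat.one_le_iff_ne_zero.2 hk
      have hadd := tsub_add_cancel_of_le hle
      rw [Finset.sum_eq_single (α - Finsupp.single k 1, Finsupp.single k 1)]
      · have h1 : multiFactorial (Finsupp.single k 1 : ι →₀ ℕ) = 1 := by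
          simp [multiFactorial]
        have h2 := multiFactorial_add_single (α - Finsupp.single k 1) k
        rw [hadd] at h2
        have h3 : (((α - Finsupp.single k 1 : ι →₀ ℕ) k : ℕ) : ℝ) + 1 = α k := by
          rw [Finsupp.tsub_apply, Finsupp.single_eq_same]
          exact_mod_cast Nat.succ_pred_eq_of_ne_zero hk
        rw [h3] at h2
        have h4 := (multiFactorial_pos (α - Finsupp.single k 1)).ne'
        simp only [h1, mul_one, h2]
        rw [mul_div_assoc, div_self h4]
        simp [xiSeries, monomialSeries]
      · rintro p hp hne
        rw [xiSeries, monomialSeries, if_neg, zero_smul, smul_zero]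
        intro hp2
        refine hne (Prod.ext ?_ hp2)
        have := Finset.HasAntidiagonal.mem_antidiagonal.1 hp
        rw [hp2] at this
        simp [← this]
      · intro hp
        exact absurd (Finset.HasAntidiagonal.mem_antidiagonal.2 hadd) hp
  rw [skorokhod, finsum_eq_sum_of_support_subset (s := α.support)]
  · refine Finset.sum_congr rfl fun k hk => ?_
    rw [hwick, if_neg (Finsupp.mem_support_iff.1 hk)]
  · intro k hk
    rw [Function.mem_support, hwick] at hk
    by_contra hne
    exact hk (if_pos (by simpa using hne))

/-- A weighted chaos part of a generalized random element is a generalized random element. -/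
theorem MemChaos.weightedChaosPart [NormedAddCommGroup X] [NormedSpace ℝ X] {p q : ι → ℝ}
    {r : ℝ} {u : ChaosSeries ι X} (hp : IsWeightSequence p) (hq : IsWeightSequence q)
    (hu : MemChaos p r u) (n : ℕ) :
    MemChaos (fun k => q k * p k ^ |r|) (-1) (weightedChaosPart q n u) := by
  refine Summable.of_nonneg_of_le (fun α => ?_) (fun α => ?_) hu
  · have := weightPow_pos (q := fun k => q k * p k ^ |r|)
      (fun k => one_le_mul_of_one_le_of_one_le (hq k) (Real.one_le_rpow (hp k) (abs_nonneg r)))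
      (2 * -1) α
    positivity
  · have hw := weightPow_pos hp (2 * r) α
    rw [SkorokhodEvolution.weightedChaosPart]
    split_ifs with hdeg
    · rw [norm_smul, mul_pow, Real.norm_eq_abs, sq_abs, ← mul_assoc, div_mul_eq_mul_div]
      refine mul_le_mul_of_nonneg_right ?_ (sq_nonneg _)
      refine div_le_div_of_nonneg_right ?_ (by positivity)
      rw [weightPow, weightPow, weightPow, Finsupp.prod, Finsupp.prod, Finsupp.prod,
        ← Finset.prod_pow, ← Finset.prod_mul_distrib]
      refine Finset.prod_le_prod (fun k _ => ?_) fun k _ => ?_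
      · have := one_pos.trans_le (hq k)
        have := one_pos.trans_le (hp k)
        positivity
      · have hqk := one_pos.trans_le (hq k)
        have hpk := one_pos.trans_le (hp k)
        -- The exponent `-1` makes the new weight cancel the square of `q^α`; what remains is
        -- `p^{-2|r|α} ≤ p^{2rα}`, valid for either sign of `r` because `p ≥ 1`.
        rw [Real.mul_rpow hqk.le (by positivity), ← Real.rpow_mul hpk.le,
          ← Real.rpow_mul_natCast hqk.le, mul_right_comm, ← Real.rpow_add hqk]
        have e1 : 2 * -1 * (α k : ℝ) + 1 * (α k : ℝ) * (2 : ℕ) = 0 := by push_cast; ring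
        rw [e1, Real.rpow_zero, one_mul]
        refine Real.rpow_le_rpow_of_exponent_le (hp k) ?_
        have : (0 : ℝ) ≤ α k := by positivity
        nlinarith [neg_abs_le r]
    · rw [norm_zero, zero_pow two_ne_zero, mul_zero]
      positivity

end Chaos

/-! ### Integration over a set and operator families as bounded operators on `L₂` spaces. -/

section Operators

/-- The set is enlarged to the whole space, and Cauchy–Schwarz is applied against the constant `1`.
-/
theorem norm_setIntegral_Lp_le {α E : Type*} [MeasurableSpace α] [NormedAddCommGroup E]
    [NormedSpace ℝ E] (μ : Measure α) [IsFiniteMeasure μ] (B : Set α) (w : Lp E 2 μ) :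
    ‖∫ r in B, w r ∂μ‖ ≤ μ.real Set.univ ^ (1 / 2 : ℝ) * ‖w‖ := by
  have hi : Integrable w μ := (Lp.memLp w).integrable one_le_two
  have h1 : ‖∫ r in B, w r ∂μ‖ ≤ ∫ r, ‖w r‖ ∂μ :=
    (norm_integral_le_integral_norm _).trans
      (setIntegral_le_integral hi.norm (Eventually.of_forall fun _ => norm_nonneg _))
  refine h1.trans ?_
  rw [integral_norm_eq_lintegral_enorm hi.1, ← eLpNorm_one_eq_lintegral_enorm]
  have h2 := eLpNorm_le_eLpNorm_mul_rpow_measure_univ (p := 1) (q := 2) (μ := μ)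
    (f := w) one_le_two hi.1
  have h3 := ENNReal.toReal_mono
    (ENNReal.mul_ne_top (Lp.eLpNorm_ne_top w)
      (ENNReal.rpow_ne_top_of_nonneg (by norm_num) (measure_ne_top μ _))) h2
  rw [ENNReal.toReal_mul, ← Lp.norm_def, ← ENNReal.toReal_rpow] at h3
  rw [mul_comm]
  norm_num at h3 ⊢
  exact h3

/-- The integral over a set, as a linear map on the square integrable functions of a finite measure
space. -/
noncomputable def setIntegralLinearMap {α E : Type*} [MeasurableSpace α] [NormedAddCommGroup E]
    [NormedSpace ℝ E] (μ : Measure α) [IsFiniteMeasure μ] (B : Set α) : Lp E 2 μ →ₗ[ℝ] E where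
  toFun := fun w => ∫ r in B, w r ∂μ
  map_add' := fun w w' => by
    have hi : ∀ w : Lp E 2 μ, Integrable w μ := fun w => (Lp.memLp w).integrable one_le_two
    rw [integral_congr_ae (ae_restrict_of_ae (Lp.coeFn_add w w'))]
    exact integral_add (hi w).integrableOn (hi w').integrableOn
  map_smul' := fun c w => by
    rw [integral_congr_ae (ae_restrict_of_ae (Lp.coeFn_smul c w))]
    exact integral_smul c _

/-- The integral over a set, as a continuous linear map on the square integrable functions of a
finite measure space. -/
noncomputable def setIntegralL {α E : Type*} [MeasurableSpace α] [NormedAddCommGroup E]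
    [NormedSpace ℝ E] (μ : Measure α) [IsFiniteMeasure μ] (B : Set α) : Lp E 2 μ →L[ℝ] E :=
  (setIntegralLinearMap μ B).mkContinuous (μ.real Set.univ ^ (1 / 2 : ℝ))
    fun w => norm_setIntegral_Lp_le μ B w

theorem setIntegralL_apply {α E : Type*} [MeasurableSpace α] [NormedAddCommGroup E]
    [NormedSpace ℝ E] (μ : Measure α) [IsFiniteMeasure μ] (B : Set α) (w : Lp E 2 μ) :
    setIntegralL μ B w = ∫ r in B, w r ∂μ :=
  rfl

theorem norm_setIntegralL_apply_le {α E : Type*} [MeasurableSpace α] [NormedAddCommGroup E]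
    [NormedSpace ℝ E] (μ : Measure α) [IsFiniteMeasure μ] (B : Set α) (w : Lp E 2 μ) :
    ‖setIntegralL μ B w‖ ≤ μ.real Set.univ ^ (1 / 2 : ℝ) * ‖w‖ := by
  rw [setIntegralL_apply]
  exact norm_setIntegral_Lp_le μ B w

/-- The action of an operator family on square integrable functions. -/
noncomputable def OperatorFamily.applyL {T : ℝ} {V V' : Type*} [NormedAddCommGroup V]
    [NormedSpace ℝ V] [NormedAddCommGroup V'] [NormedSpace ℝ V'] (B : OperatorFamily T V V') :
    L2Time 0 T V →L[ℝ] L2Time 0 T V' :=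
  LinearMap.mkContinuous
    { toFun := B.apply
      map_add' := fun v w => by
        refine Lp.ext ?_
        filter_upwards [(B.memLp_apply (v + w)).coeFn_toLp, (B.memLp_apply v).coeFn_toLp,
          (B.memLp_apply w).coeFn_toLp, Lp.coeFn_add v w,
          Lp.coeFn_add (B.apply v) (B.apply w)] with t h1 h2 h3 h4 h5
        rw [h5, Pi.add_apply]
        simp only [OperatorFamily.apply]
        rw [h1, h2, h3, h4, Pi.add_apply, map_add]
      map_smul' := fun c v => by
        refine Lp.ext ?_
        filter_upwards [(B.memLp_apply (c • v)).coeFn_toLp, (B.memLp_apply v).coeFn_toLp,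
          Lp.coeFn_smul c v, Lp.coeFn_smul c (B.apply v)] with t h1 h2 h4 h5
        rw [RingHom.id_apply, h5, Pi.smul_apply]
        simp only [OperatorFamily.apply]
        rw [h1, h2, h4, Pi.smul_apply, map_smul] }
    B.bounded.choose fun v => by
      refine Lp.norm_le_mul_norm_of_ae_le_mul ?_
      filter_upwards [(B.memLp_apply v).coeFn_toLp, B.bounded.choose_spec] with t h1 h2
      change ‖(B.memLp_apply v).toLp _ t‖ ≤ _
      rw [h1]
      exact (B.op t).le_of_opNorm_le h2 _

theorem OperatorFamily.applyL_apply {T : ℝ} {V V' : Type*} [NormedAddCommGroup V]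
    [NormedSpace ℝ V] [NormedAddCommGroup V'] [NormedSpace ℝ V'] (B : OperatorFamily T V V')
    (v : L2Time 0 T V) : B.applyL v = B.apply v :=
  rfl

theorem OperatorFamily.coeFn_apply {T : ℝ} {V V' : Type*} [NormedAddCommGroup V]
    [NormedSpace ℝ V] [NormedAddCommGroup V'] [NormedSpace ℝ V'] (B : OperatorFamily T V V')
    (v : L2Time 0 T V) :
    B.apply v =ᵐ[volume.restrict (Set.Ioc 0 T)] fun t => B.op t (v t) :=
  (B.memLp_apply v).coeFn_toLp

end Operators

/-! ### Restriction and extension by zero between `(s, T]` and `(0, T]`. -/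

section TimeIntervals

variable {E : Type*} [NormedAddCommGroup E]

theorem restrict_Ioc_le {s T : ℝ} (hs : 0 ≤ s) :
    (volume : Measure ℝ).restrict (Set.Ioc s T) ≤ volume.restrict (Set.Ioc 0 T) :=
  Measure.restrict_mono (Set.Ioc_subset_Ioc_left hs) le_rfl

theorem intervalIntegral_eq_setIntegralL [NormedSpace ℝ E] {s t T : ℝ} (hs : 0 ≤ s)
    (ht : t ∈ Set.Ioc s T) {f : ℝ → E} {w : L2Time 0 T E}
    (hf : f =ᵐ[volume.restrict (Set.Ioc s T)] w) :
    ∫ r in s..t, f r = setIntegralL (volume.restrict (Set.Ioc 0 T)) (Set.Ioc s t) w := by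
  rw [setIntegralL_apply, Measure.restrict_restrict measurableSet_Ioc, Set.inter_eq_self_of_subset_left
    (Set.Ioc_subset_Ioc hs ht.2), intervalIntegral.integral_of_le ht.1.le]
  exact integral_congr_ae
    (ae_mono (Measure.restrict_mono (Set.Ioc_subset_Ioc_right ht.2) le_rfl) hf)

/-- Restriction of a function on `(0, T]` to `(s, T]`. -/
noncomputable def restrictTime {T : ℝ} (s : ℝ) (hs : 0 ≤ s) (w : L2Time 0 T E) : L2Time s T E :=
  ((Lp.memLp w).mono_measure (restrict_Ioc_le hs)).toLp w

theorem coeFn_restrictTime {s T : ℝ} (hs : 0 ≤ s) (w : L2Time 0 T E) :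
    restrictTime s hs w =ᵐ[volume.restrict (Set.Ioc s T)] w :=
  MemLp.coeFn_toLp _

theorem norm_restrictTime_le {s T : ℝ} (hs : 0 ≤ s) (w : L2Time 0 T E) :
    ‖restrictTime s hs w‖ ≤ ‖w‖ := by
  rw [restrictTime, Lp.norm_toLp, Lp.norm_def]
  exact ENNReal.toReal_mono (Lp.eLpNorm_ne_top w) (eLpNorm_mono_measure _ (restrict_Ioc_le hs))

theorem memLp_indicator_Ioc {s T : ℝ} (hs : 0 ≤ s) (w : L2Time s T E) :
    MemLp ((Set.Ioc s T).indicator w) 2 (volume.restrict (Set.Ioc 0 T)) := by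
  rw [memLp_indicator_iff_restrict measurableSet_Ioc, Measure.restrict_restrict measurableSet_Ioc,
    Set.inter_eq_self_of_subset_left (Set.Ioc_subset_Ioc_left hs)]
  exact Lp.memLp w

/-- Extension by zero of a function on `(s, T]` to `(0, T]`. -/
noncomputable def extendTime {T : ℝ} (s : ℝ) (hs : 0 ≤ s) (w : L2Time s T E) : L2Time 0 T E :=
  (memLp_indicator_Ioc hs w).toLp _

theorem coeFn_extendTime {s T : ℝ} (hs : 0 ≤ s) (w : L2Time s T E) :
    extendTime s hs w =ᵐ[volume.restrict (Set.Ioc s T)] w := by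
  have h := ae_mono (restrict_Ioc_le (T := T) hs) (memLp_indicator_Ioc hs w).coeFn_toLp
  filter_upwards [h, ae_restrict_mem measurableSet_Ioc] with t h1 h2
  rw [extendTime, h1, Set.indicator_of_mem h2]

theorem coeFn_extendTime_zero {s T : ℝ} (hs : 0 ≤ s) (hsT : s ≤ T) (w : L2Time s T E) :
    extendTime s hs w =ᵐ[volume.restrict (Set.Ioc 0 s)] 0 := by
  have h := ae_mono (Measure.restrict_mono (Set.Ioc_subset_Ioc_right hsT) le_rfl)
    (memLp_indicator_Ioc hs w).coeFn_toLp
  filter_upwards [h, ae_restrict_mem measurableSet_Ioc] with t h1 h2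
  rw [extendTime, h1, Set.indicator_of_notMem (fun h => absurd h.1 (not_lt.2 h2.2))]
  rfl

theorem norm_extendTime {s T : ℝ} (hs : 0 ≤ s) (w : L2Time s T E) :
    ‖extendTime s hs w‖ = ‖w‖ := by
  rw [extendTime, Lp.norm_toLp, Lp.norm_def, eLpNorm_indicator_eq_eLpNorm_restrict measurableSet_Ioc,
    Measure.restrict_restrict measurableSet_Ioc,
    Set.inter_eq_self_of_subset_left (Set.Ioc_subset_Ioc_left hs)]

theorem ae_restrict_Ioc_of_ae {s T : ℝ} (hs : s ∈ Set.Icc 0 T) {p : ℝ → Prop}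
    (h1 : ∀ᵐ t ∂(volume.restrict (Set.Ioc 0 s)), p t)
    (h2 : ∀ᵐ t ∂(volume.restrict (Set.Ioc s T)), p t) :
    ∀ᵐ t ∂(volume.restrict (Set.Ioc 0 T)), p t := by
  rw [← Set.Ioc_union_Ioc_eq_Ioc hs.1 hs.2, ae_restrict_union_iff]
  exact ⟨h1, h2⟩

end TimeIntervals

/-! ### Solution operators for all initial times, with values in one fixed space. -/

section Solution

variable {V H V' : Type*} [NormedAddCommGroup V] [InnerProductSpace ℝ V]
  [NormedAddCommGroup H] [InnerProductSpace ℝ H]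
  [NormedAddCommGroup V'] [InnerProductSpace ℝ V'] {T : ℝ}

/-- `X` vanishes before time `s` and solves the deterministic equation with initial value `x` and
forcing `F` after time `s`. -/
def IsSolutionFrom (N : NormalTriple V H V') (A : OperatorFamily T V V') (s : ℝ) (x : H)
    (F : L2Time 0 T V') (X : L2Time 0 T V) : Prop :=
  X =ᵐ[volume.restrict (Set.Ioc 0 s)] 0 ∧ ∀ᵐ t ∂(volume.restrict (Set.Ioc s T)),
    N.incl' (N.incl (X t)) = N.incl' x
      + setIntegralL (volume.restrict (Set.Ioc 0 T)) (Set.Ioc s t) (A.applyL X + F)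

variable {N : NormalTriple V H V'} {A : OperatorFamily T V V'}

/-- This moves the problem from the `s`-dependent space over `(s, T]` to the fixed space over `(0,
T]`, where solutions with different initial times can be compared and integrated in `s`. -/
theorem ae_eqn_iff {s : ℝ} (hs : 0 ≤ s) {x : H} {F : L2Time s T V'} {X : L2Time s T V}
    {F₀ : L2Time 0 T V'} {X₀ : L2Time 0 T V}
    (hF : F =ᵐ[volume.restrict (Set.Ioc s T)] F₀) (hX : X =ᵐ[volume.restrict (Set.Ioc s T)] X₀) :
    IsDetSolution N A s x F X ↔ ∀ᵐ t ∂(volume.restrict (Set.Ioc s T)),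
      N.incl' (N.incl (X₀ t)) = N.incl' x
        + setIntegralL (volume.restrict (Set.Ioc 0 T)) (Set.Ioc s t) (A.applyL X₀ + F₀) := by
  have hint : (fun r => A.op r (X r) + F r) =ᵐ[volume.restrict (Set.Ioc s T)]
      (A.applyL X₀ + F₀ : L2Time 0 T V') := by
    filter_upwards [hF, hX, ae_mono (restrict_Ioc_le hs) (A.coeFn_apply X₀),
      ae_mono (restrict_Ioc_le hs) (Lp.coeFn_add (A.applyL X₀) F₀)] with r h1 h2 h3 h4
    rw [h4, Pi.add_apply, A.applyL_apply, h3, h1, h2]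
  refine Filter.eventually_congr ?_
  filter_upwards [hX, ae_restrict_mem measurableSet_Ioc] with t h1 h2
  rw [h1, intervalIntegral_eq_setIntegralL hs h2 hint]

theorem IsDetSolution.extendTime {s : ℝ} (hs : s ∈ Set.Ico 0 T) {x : H} {F : L2Time s T V'}
    {F₀ : L2Time 0 T V'} (hF : F =ᵐ[volume.restrict (Set.Ioc s T)] F₀) {X : L2Time s T V}
    (h : IsDetSolution N A s x F X) : IsSolutionFrom N A s x F₀ (extendTime s hs.1 X) :=
  ⟨coeFn_extendTime_zero hs.1 hs.2.le X, (ae_eqn_iff hs.1 hF (coeFn_extendTime hs.1 X).symm).1 h⟩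

theorem IsSolutionFrom.restrictTime {s : ℝ} (hs : 0 ≤ s) {x : H} {F : L2Time 0 T V'}
    {X : L2Time 0 T V} (h : IsSolutionFrom N A s x F X) :
    IsDetSolution N A s x (restrictTime s hs F) (restrictTime s hs X) :=
  (ae_eqn_iff hs (coeFn_restrictTime hs F) (coeFn_restrictTime hs X)).2 h.2

theorem isSolutionFrom_zero_iff {x : H} {F : L2Time 0 T V'} {X : L2Time 0 T V} :
    IsSolutionFrom N A 0 x F X ↔ IsDetSolution N A 0 x F X := by
  rw [ae_eqn_iff le_rfl (ae_eq_refl _) (ae_eq_refl _), IsSolutionFrom]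
  refine and_iff_right ?_
  simp [Filter.EventuallyEq]

theorem IsSolutionFrom.add_smul {s : ℝ} (hs : s ∈ Set.Ico 0 T) {x y : H} {F G : L2Time 0 T V'}
    {X Y : L2Time 0 T V} (c : ℝ) (hX : IsSolutionFrom N A s x F X)
    (hY : IsSolutionFrom N A s y G Y) :
    IsSolutionFrom N A s (x + c • y) (F + c • G) (X + c • Y) := by
  have hadd := (Lp.coeFn_add X (c • Y)).trans ((ae_eq_refl _).add (Lp.coeFn_smul c Y))
  constructor
  · filter_upwards [hX.1, hY.1, ae_mono
      (Measure.restrict_mono (Set.Ioc_subset_Ioc_right hs.2.le) le_rfl) hadd] with t h1 h2 h3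
    rw [h3]
    simp [h1, h2]
  · filter_upwards [hX.2, hY.2, ae_mono (restrict_Ioc_le hs.1) hadd] with t h1 h2 h3
    have e : A.applyL (X + c • Y) + (F + c • G)
        = (A.applyL X + F) + c • (A.applyL Y + G) := by
      rw [map_add, map_smul]; module
    rw [h3, e, map_add (setIntegralL _ _), map_smul (setIntegralL _ _), Pi.add_apply, Pi.smul_apply,
      map_add N.incl, map_add N.incl', map_smul N.incl, map_smul N.incl', h1, h2,
      map_add N.incl', map_smul N.incl']
    module

theorem WellPosed.exists_isSolutionFrom (hA : WellPosed N A) :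
    ∃ C : ℝ, 0 ≤ C ∧ ∀ s ∈ Set.Ico 0 T, ∀ (x : H) (F : L2Time 0 T V'),
      ∃ X : L2Time 0 T V, (∀ Y, IsSolutionFrom N A s x F Y ↔ Y = X) ∧
        ‖X‖ ≤ C * (‖x‖ + ‖F‖) := by
  obtain ⟨C, hC⟩ := hA
  -- The constant of well-posedness carries no sign; later estimates need a non-negative one.
  refine ⟨max C 0, le_max_right _ _, fun s hs x F => ?_⟩
  obtain ⟨X, h1, h2, h3⟩ := hC s hs x (restrictTime s hs.1 F)
  refine ⟨extendTime s hs.1 X, fun Y => ⟨fun hY => ?_, ?_⟩, ?_⟩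
  · have hres := h2 _ (hY.restrictTime hs.1)
    refine Lp.ext (ae_restrict_Ioc_of_ae ⟨hs.1, hs.2.le⟩ ?_ ?_)
    · exact hY.1.trans (coeFn_extendTime_zero hs.1 hs.2.le X).symm
    · refine (coeFn_restrictTime hs.1 Y).symm.trans ?_
      rw [hres]
      exact (coeFn_extendTime hs.1 X).symm
  · rintro rfl
    exact h1.extendTime hs (coeFn_restrictTime hs.1 F)
  · rw [norm_extendTime]
    refine h3.trans ?_
    have := norm_restrictTime_le hs.1 F
    gcongr
    exact le_max_left _ _

/-- The solution operators of a well-posed deterministic equation, for all initial times. -/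
theorem WellPosed.exists_solutionOperator (hA : WellPosed N A) :
    ∃ (S : ℝ → (H × L2Time 0 T V') →L[ℝ] L2Time 0 T V) (C : ℝ), 0 ≤ C ∧
      (∀ s ∈ Set.Ico 0 T, ∀ x F X, IsSolutionFrom N A s x F X ↔ X = S s (x, F)) ∧
      ∀ s x F, ‖S s (x, F)‖ ≤ C * (‖x‖ + ‖F‖) := by
  classical
  obtain ⟨C, hC0, hC⟩ := hA.exists_isSolutionFrom
  have hS : ∀ s, ∃ L : (H × L2Time 0 T V') →L[ℝ] L2Time 0 T V,
      (s ∈ Set.Ico 0 T → ∀ x F X, IsSolutionFrom N A s x F X ↔ X = L (x, F)) ∧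
      ∀ x F, ‖L (x, F)‖ ≤ C * (‖x‖ + ‖F‖) := fun s => by
    by_cases hs : s ∈ Set.Ico 0 T
    · choose g hg1 hg2 using hC s hs
      have hsol : ∀ x F, IsSolutionFrom N A s x F (g x F) := fun x F => (hg1 x F _).2 rfl
      have hlin : ∀ (p p' : H × L2Time 0 T V') (c : ℝ),
          g (p + c • p').1 (p + c • p').2 = g p.1 p.2 + c • g p'.1 p'.2 := fun p p' c =>
        ((hg1 _ _ _).1 ((hsol p.1 p.2).add_smul hs c (hsol p'.1 p'.2))).symm
      have h0 : g 0 0 = 0 := by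
        have := hlin 0 0 (-1)
        simpa using this
      let L : (H × L2Time 0 T V') →ₗ[ℝ] L2Time 0 T V :=
        { toFun := fun p => g p.1 p.2
          map_add' := fun p p' => by simpa using hlin p p' 1
          map_smul' := fun c p => by simpa [h0] using hlin 0 p c }
      -- The product carries the maximum norm, so `‖x‖ + ‖F‖` is at most twice the norm of the pair.
      refine ⟨L.mkContinuous (C * 2) fun p => ?_, fun _ x F X => hg1 x F X, fun x F => hg2 x F⟩
      refine (hg2 p.1 p.2).trans ?_
      rw [mul_assoc]
      refine mul_le_mul_of_nonneg_left ?_ hC0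
      linarith [norm_fst_le p, norm_snd_le p]
    · exact ⟨0, fun h => absurd h hs, fun x F => by simpa using by positivity⟩
  choose S h1 h2 using hS
  exact ⟨S, C, hC0, fun s hs => h1 s hs, h2⟩

end Solution

/-! ### The Volterra operator on `L₂` and functions that vanish before a given time. -/

section Volterra

variable {E : Type*} [NormedAddCommGroup E] [NormedSpace ℝ E]

theorem memLp_setIntegralL_Ioc (T : ℝ) (w : L2Time 0 T E) :
    MemLp (fun t => setIntegralL (volume.restrict (Set.Ioc 0 T)) (Set.Ioc 0 t) w) 2
      (volume.restrict (Set.Ioc 0 T)) := by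
  have hint : Integrable w (volume.restrict (Set.Ioc 0 T)) :=
    (Lp.memLp w).integrable one_le_two
  have hcont : Continuous fun t => ∫ r in (0 : ℝ)..t, w r ∂(volume.restrict (Set.Ioc 0 T)) :=
    intervalIntegral.continuous_primitive (fun _ _ => hint.intervalIntegrable) 0
  have hmeas : AEStronglyMeasurable
      (fun t => setIntegralL (volume.restrict (Set.Ioc 0 T)) (Set.Ioc 0 t) w)
      (volume.restrict (Set.Ioc 0 T)) := by
    refine hcont.aestronglyMeasurable.congr ?_
    filter_upwards [ae_restrict_mem measurableSet_Ioc] with t ht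
    rw [intervalIntegral.integral_of_le ht.1.le]
    rfl
  refine MemLp.of_bound hmeas
    ((volume.restrict (Set.Ioc 0 T)).real Set.univ ^ (1 / 2 : ℝ) * ‖w‖)
    (Eventually.of_forall fun t => ?_)
  exact norm_setIntegralL_apply_le (volume.restrict (Set.Ioc 0 T)) (Set.Ioc 0 t) w

/-- The Volterra operator `(K w)(t) = ∫₀ᵗ w(r) dr`, as a linear map. -/
noncomputable def volterraLinearMap (T : ℝ) : L2Time 0 T E →ₗ[ℝ] L2Time 0 T E where
  toFun := fun w => (memLp_setIntegralL_Ioc T w).toLp _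
  map_add' := fun w w' => by
    rw [← MemLp.toLp_add]
    congr 1
    funext t
    exact map_add _ w w'
  map_smul' := fun c w => by
    rw [RingHom.id_apply, ← MemLp.toLp_const_smul]
    congr 1
    funext t
    exact map_smul _ c w

theorem coeFn_volterraLinearMap {T : ℝ} (w : L2Time 0 T E) :
    volterraLinearMap T w =ᵐ[volume.restrict (Set.Ioc 0 T)] fun t =>
      setIntegralL (volume.restrict (Set.Ioc 0 T)) (Set.Ioc 0 t) w :=
  (memLp_setIntegralL_Ioc T w).coeFn_toLp

theorem norm_volterraLinearMap_le {T : ℝ} (w : L2Time 0 T E) :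
    ‖volterraLinearMap T w‖ ≤ measureUnivNNReal (volume.restrict (Set.Ioc 0 T))
      ^ (2 : ℝ≥0∞).toReal⁻¹ * (volume.restrict (Set.Ioc 0 T)).real Set.univ ^ (1 / 2 : ℝ) * ‖w‖ := by
  rw [mul_assoc]
  refine Lp.norm_le_of_ae_bound (mul_nonneg (Real.rpow_nonneg measureReal_nonneg _)
    (norm_nonneg _)) ?_
  filter_upwards [coeFn_volterraLinearMap w] with t ht
  rw [ht]
  exact norm_setIntegralL_apply_le (volume.restrict (Set.Ioc 0 T)) (Set.Ioc 0 t) w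

/-- The Volterra operator `(K w)(t) = ∫₀ᵗ w(r) dr`. -/
noncomputable def volterra (T : ℝ) : L2Time 0 T E →L[ℝ] L2Time 0 T E :=
  (volterraLinearMap T).mkContinuous
    (measureUnivNNReal (volume.restrict (Set.Ioc 0 T))
      ^ (2 : ℝ≥0∞).toReal⁻¹ * (volume.restrict (Set.Ioc 0 T)).real Set.univ ^ (1 / 2 : ℝ))
    fun w => norm_volterraLinearMap_le w

theorem coeFn_volterra {T : ℝ} (w : L2Time 0 T E) :
    volterra T w =ᵐ[volume.restrict (Set.Ioc 0 T)] fun t =>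
      setIntegralL (volume.restrict (Set.Ioc 0 T)) (Set.Ioc 0 t) w :=
  coeFn_volterraLinearMap w

theorem setIntegralL_Ioc_eq_of_ae_eq_zero {s' s T : ℝ} (hs' : 0 ≤ s') (hs : s' ≤ s)
    {w : L2Time 0 T E} (hw : w =ᵐ[volume.restrict (Set.Ioc 0 s)] 0) (t : ℝ) :
    setIntegralL (volume.restrict (Set.Ioc 0 T)) (Set.Ioc s' t) w
      = setIntegralL (volume.restrict (Set.Ioc 0 T)) (Set.Ioc s t) w := by
  rw [setIntegralL_apply, setIntegralL_apply]
  refine setIntegral_eq_of_subset_of_ae_sdiff_eq_zero measurableSet_Ioc.nullMeasurableSet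
    (Set.Ioc_subset_Ioc_left hs) (ae_restrict_of_ae ?_)
  filter_upwards [(ae_restrict_iff' measurableSet_Ioc).1 hw] with r hr hmem
  refine hr ⟨hs'.trans_lt hmem.1.1, ?_⟩
  by_contra hlt
  exact hmem.2 ⟨not_le.1 hlt, hmem.1.2⟩

theorem setIntegralL_Ioc_eq_zero {s t T : ℝ} (hs : 0 ≤ s) (hts : t ≤ s)
    {w : L2Time 0 T E} (hw : w =ᵐ[volume.restrict (Set.Ioc 0 s)] 0) :
    setIntegralL (volume.restrict (Set.Ioc 0 T)) (Set.Ioc 0 t) w = 0 := by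
  rw [setIntegralL_Ioc_eq_of_ae_eq_zero le_rfl hs hw, setIntegralL_apply,
    Set.Ioc_eq_empty (not_lt.2 hts), Measure.restrict_empty, integral_zero_measure]

end Volterra

/-! ### Dependence on the initial time, Duhamel's formula and the evolution integral. -/

section Duhamel

variable {V H V' : Type*} [NormedAddCommGroup V] [InnerProductSpace ℝ V]
  [NormedAddCommGroup H] [InnerProductSpace ℝ H]
  [NormedAddCommGroup V'] [InnerProductSpace ℝ V'] {T : ℝ}
  {N : NormalTriple V H V'} {A : OperatorFamily T V V'}

theorem applyL_ae_eq_zero {s : ℝ} (hs : s ≤ T) {X : L2Time 0 T V}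
    (hX : X =ᵐ[volume.restrict (Set.Ioc 0 s)] 0) :
    A.applyL X =ᵐ[volume.restrict (Set.Ioc 0 s)] 0 := by
  filter_upwards [hX, ae_mono (Measure.restrict_mono (Set.Ioc_subset_Ioc_right hs) le_rfl)
    (A.coeFn_apply X)] with t h1 h2
  rw [A.applyL_apply, h2, h1]
  simp

/-- Changing the initial time of a solution with initial value in `V`. -/
theorem IsSolutionFrom.sub_sub_indicator {s' s : ℝ} (hs' : 0 ≤ s') (hs : s' ≤ s) (hsT : s < T)
    {v : V} {X' X : L2Time 0 T V} (hX' : IsSolutionFrom N A s' (N.incl v) 0 X')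
    (hX : IsSolutionFrom N A s (N.incl v) 0 X) :
    IsSolutionFrom N A s' 0
      (A.applyL (indicatorConstLp 2 (measurableSet_Ioc (a := s') (b := s)) (measure_ne_top _ _) v))
      (X' - X -
        indicatorConstLp 2 (measurableSet_Ioc (a := s') (b := s)) (measure_ne_top _ _) v) := by
  set w : L2Time 0 T V :=
    indicatorConstLp 2 (measurableSet_Ioc (a := s') (b := s)) (measure_ne_top _ _) v with hw
  have hwt : w =ᵐ[volume.restrict (Set.Ioc 0 T)] (Set.Ioc s' s).indicator fun _ => v :=
    indicatorConstLp_coeFn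
  have hsub : (X' - X - w : L2Time 0 T V) =ᵐ[volume.restrict (Set.Ioc 0 T)]
      fun t => X' t - X t - (Set.Ioc s' s).indicator (fun _ => v) t := by
    filter_upwards [hwt, Lp.coeFn_sub X' X, Lp.coeFn_sub (X' - X) w] with t h1 h2 h3
    rw [h3, Pi.sub_apply, h2, Pi.sub_apply, h1]
  have hX0 := (ae_restrict_iff' measurableSet_Ioc).1 hX.1
  constructor
  · filter_upwards [hX'.1, ae_mono (Measure.restrict_mono
      (Set.Ioc_subset_Ioc_right (hs.trans hsT.le)) le_rfl) hsub, ae_restrict_of_ae hX0,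
      ae_restrict_mem measurableSet_Ioc] with t h1 h2 h3 h4
    rw [h2, h1, h3 ⟨h4.1, h4.2.trans hs⟩, Set.indicator_of_notMem
      (fun h => absurd h.1 (not_lt.2 h4.2))]
    simp
  · have hX1 := (ae_restrict_iff' measurableSet_Ioc).1 hX.2
    filter_upwards [hX'.2, ae_mono (restrict_Ioc_le hs') hsub, ae_restrict_of_ae hX0,
      ae_restrict_of_ae hX1, ae_restrict_mem measurableSet_Ioc] with t h1 h2 h3 h4 h5
    -- The forcing `A w` undoes the subtraction of `w = 1_{(s', s]} v`. On `(s', s]`, `X = 0` and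
    -- `w` removes the initial value of `X'`; after `s`, `w = 0` and the two initial values cancel.
    have e : A.applyL (X' - X - w) + A.applyL w = A.applyL X' - A.applyL X := by
      rw [map_sub, map_sub]; abel
    rw [add_zero] at h1 h4
    rw [e, map_sub (setIntegralL _ _), setIntegralL_Ioc_eq_of_ae_eq_zero hs' hs
      (applyL_ae_eq_zero hsT.le hX.1), h2, map_sub N.incl, map_sub N.incl, map_sub N.incl',
      map_sub N.incl', h1, map_zero, zero_add]
    by_cases hts : t ≤ s
    · rw [h3 ⟨hs'.trans_lt h5.1, hts⟩, Set.indicator_of_mem (show t ∈ Set.Ioc s' s from ⟨h5.1, hts⟩),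
        setIntegralL_apply, setIntegralL_apply, Set.Ioc_eq_empty (not_lt.2 hts)]
      simp
    · rw [h4 ⟨not_le.1 hts, h5.2⟩, Set.indicator_of_notMem (fun h => hts h.2)]
      simp

variable {S : ℝ → (H × L2Time 0 T V') →L[ℝ] L2Time 0 T V} {C : ℝ}

/-- The difference equals `S s' (0, A w) + w` with `w` the constant `v` on `(s', s]`, and `‖w‖ ≤ ‖v‖
|s' - s|^{1/2}`. Taking `v ∈ V` is what makes `w` an element of `L₂((0, T); V)`. -/
theorem norm_solutionOperator_sub_le
    (hS : ∀ s ∈ Set.Ico 0 T, ∀ x F X, IsSolutionFrom N A s x F X ↔ X = S s (x, F))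
    (hC0 : 0 ≤ C) (hSC : ∀ s x F, ‖S s (x, F)‖ ≤ C * (‖x‖ + ‖F‖)) (v : V) {s' s : ℝ}
    (hs' : 0 ≤ s') (hs : s' ≤ s) (hsT : s < T) :
    ‖S s' (N.incl v, 0) - S s (N.incl v, 0)‖
      ≤ (1 + C * ‖A.applyL‖) * ‖v‖ * |s' - s| ^ (1 / 2 : ℝ) := by
  have h := ((hS s' ⟨hs', hs.trans_lt hsT⟩ (N.incl v) 0 _).2 rfl).sub_sub_indicator hs' hs hsT
    ((hS s ⟨hs'.trans hs, hsT⟩ (N.incl v) 0 _).2 rfl)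
  set w : L2Time 0 T V :=
    indicatorConstLp 2 (measurableSet_Ioc (a := s') (b := s)) (measure_ne_top _ _) v with hw
  have hwn : ‖w‖ ≤ ‖v‖ * |s' - s| ^ (1 / 2 : ℝ) := by
    refine norm_indicatorConstLp_le.trans ?_
    have hreal : (volume.restrict (Set.Ioc 0 T)).real (Set.Ioc s' s) ≤ |s' - s| := by
      rw [abs_sub_comm, abs_of_nonneg (sub_nonneg.2 hs), ← Real.volume_real_Ioc_of_le hs]
      exact ENNReal.toReal_mono (by simp) (Measure.restrict_apply_le _ _)
    rw [ENNReal.toReal_ofNat]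
    gcongr
  have heq := (hS s' ⟨hs', hs.trans_lt hsT⟩ _ _ _).1 h
  have : S s' (N.incl v, 0) - S s (N.incl v, 0) = S s' (0, A.applyL w) + w := by
    rw [← heq]; abel
  rw [this]
  calc ‖S s' (0, A.applyL w) + w‖ ≤ C * (‖(0 : H)‖ + ‖A.applyL w‖) + ‖w‖ :=
        (norm_add_le _ _).trans (by gcongr; exact hSC _ _ _)
    _ ≤ C * (‖A.applyL‖ * ‖w‖) + ‖w‖ := by
        rw [norm_zero, zero_add]
        gcongr
        exact A.applyL.le_opNorm w
    _ = (1 + C * ‖A.applyL‖) * ‖w‖ := by ring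
    _ ≤ (1 + C * ‖A.applyL‖) * (‖v‖ * |s' - s| ^ (1 / 2 : ℝ)) := by gcongr
    _ = _ := by ring

theorem continuousOn_solutionOperator
    (hS : ∀ s ∈ Set.Ico 0 T, ∀ x F X, IsSolutionFrom N A s x F X ↔ X = S s (x, F))
    (hC0 : 0 ≤ C) (hSC : ∀ s x F, ‖S s (x, F)‖ ≤ C * (‖x‖ + ‖F‖)) (v : V) :
    ContinuousOn (fun s => S s (N.incl v, 0)) (Set.Ico 0 T) := by
  intro s hs
  refine tendsto_iff_dist_tendsto_zero.2 ?_
  have hlim : Tendsto (fun s' => (1 + C * ‖A.applyL‖) * ‖v‖ * |s' - s| ^ (1 / 2 : ℝ))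
      (𝓝[Set.Ico 0 T] s) (𝓝 0) := by
    have : Continuous fun s' => (1 + C * ‖A.applyL‖) * ‖v‖ * |s' - s| ^ (1 / 2 : ℝ) :=
      continuous_const.mul ((continuous_id.sub continuous_const).abs.rpow_const
        fun _ => Or.inr (by norm_num))
    have h := this.tendsto s
    simp only [sub_self, abs_zero, Real.zero_rpow (show (1 / 2 : ℝ) ≠ 0 by norm_num), mul_zero] at h
    exact h.mono_left nhdsWithin_le_nhds
  refine squeeze_zero' (Eventually.of_forall fun _ => dist_nonneg) ?_ hlim
  filter_upwards [self_mem_nhdsWithin] with s' hs'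
  rw [dist_eq_norm]
  rcases le_total s' s with hle | hle
  · exact norm_solutionOperator_sub_le hS hC0 hSC v hs'.1 hle hs.2
  · rw [norm_sub_rev, abs_sub_comm]
    exact norm_solutionOperator_sub_le hS hC0 hSC v hs.1 hle hs'.2

/-- The family `s ↦ S(s)` of solution operators with respect to the initial value. -/
theorem exists_operatorFamily_solutionOperator
    (hS : ∀ s ∈ Set.Ico 0 T, ∀ x F X, IsSolutionFrom N A s x F X ↔ X = S s (x, F))
    (hC0 : 0 ≤ C) (hSC : ∀ s x F, ‖S s (x, F)‖ ≤ C * (‖x‖ + ‖F‖)) :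
    ∃ D : OperatorFamily T H (L2Time 0 T V), ∀ s x, D.op s x = S s (x, 0) := by
  refine ⟨⟨fun s => (S s).comp (ContinuousLinearMap.inl ℝ H (L2Time 0 T V')), fun x => ?_, C,
    Eventually.of_forall fun s => ?_⟩, fun s x => rfl⟩
  -- Continuity in `s` is known for initial values in `V`; density of `V` in `H` passes
  -- measurability to the limit.
  · obtain ⟨x', hx', hlim⟩ := mem_closure_iff_seq_limit.1 (N.incl_dense x)
    choose v hv using hx'
    refine aestronglyMeasurable_of_tendsto_ae (u := atTop)
      (f := fun n s => S s (N.incl (v n), 0)) (fun n => ?_) (Eventually.of_forall fun s => ?_)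
    · have hm : (volume : Measure ℝ).restrict (Set.Ioc 0 T) = volume.restrict (Set.Ico 0 T) := by
        rw [← Measure.restrict_congr_set Ioo_ae_eq_Ioc, Measure.restrict_congr_set Ioo_ae_eq_Ico]
      exact ((continuousOn_solutionOperator hS hC0 hSC (v n)).aestronglyMeasurable
        measurableSet_Ico).mono_measure hm.le
    · simp only [hv]
      exact ((ContinuousLinearMap.continuous _).tendsto x).comp hlim
  · refine ContinuousLinearMap.opNorm_le_bound _ hC0 fun x => ?_
    simpa using hSC s x 0

/-- Uniqueness identifies the solution chosen in the definition with `S s (x, 0)`. Since the latter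
vanishes before `s`, the integral can start at `0`. -/
theorem evolutionFamily_eq
    (hS : ∀ s ∈ Set.Ico 0 T, ∀ x F X, IsSolutionFrom N A s x F X ↔ X = S s (x, F))
    {s t : ℝ} (hs : s ∈ Set.Ico 0 T) (ht : t ∈ Set.Ioc s T) (x : H) :
    evolutionFamily N A t s x = N.incl' x
      + setIntegralL (volume.restrict (Set.Ioc 0 T)) (Set.Ioc 0 t) (A.applyL (S s (x, 0))) := by
  have hsol : IsSolutionFrom N A s x 0 (S s (x, 0)) := (hS s hs _ _ _).2 rfl
  have hz : ((0 : L2Time s T V') : ℝ → V') =ᵐ[volume.restrict (Set.Ioc s T)]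
      (0 : L2Time 0 T V') :=
    (Lp.coeFn_zero _ _ _).trans
      (EventuallyEq.symm (ae_mono (restrict_Ioc_le hs.1) (Lp.coeFn_zero V' 2 _)))
  have hex : ∃ X : L2Time s T V, IsDetSolution N A s x 0 X :=
    ⟨restrictTime s hs.1 (S s (x, 0)),
      (ae_eqn_iff hs.1 hz (coeFn_restrictTime hs.1 _)).2 hsol.2⟩
  rw [evolutionFamily, dif_pos hex, setIntegralL_Ioc_eq_of_ae_eq_zero le_rfl hs.1
    (applyL_ae_eq_zero hs.2.le hsol.1)]
  congr 1
  refine intervalIntegral_eq_setIntegralL hs.1 ht ?_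
  have hext := (hS s hs _ _ _).1 (hex.choose_spec.extendTime hs hz)
  filter_upwards [coeFn_extendTime hs.1 hex.choose,
    ae_mono (restrict_Ioc_le hs.1) (A.coeFn_apply (S s (x, 0)))] with r h1 h2
  rw [A.applyL_apply, h2, ← hext, h1]

/-- The initial time appears only on the right: a fixed bounded operator is applied to `S s (x, 0)`,
so it can be interchanged with a Bochner integral over `s`. -/
theorem compLpL_sub_volterra_solutionOperator
    (hS : ∀ s ∈ Set.Ico 0 T, ∀ x F X, IsSolutionFrom N A s x F X ↔ X = S s (x, F))
    {s : ℝ} (hs : s ∈ Set.Ico 0 T) (x : H) :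
    (N.incl'.comp N.incl).compLpL 2 (volume.restrict (Set.Ioc 0 T)) (S s (x, 0))
      - volterra T (A.applyL (S s (x, 0)))
      = indicatorConstLp 2 (measurableSet_Ioc (a := s) (b := T)) (measure_ne_top _ _)
        (N.incl' x) := by
  have hsol : IsSolutionFrom N A s x 0 (S s (x, 0)) := (hS s hs _ _ _).2 rfl
  set X := S s (x, 0)
  have hA0 := applyL_ae_eq_zero (A := A) hs.2.le hsol.1
  refine Lp.ext ?_
  have hpt := ((Lp.coeFn_sub ((N.incl'.comp N.incl).compLpL 2 (volume.restrict (Set.Ioc 0 T)) X)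
    (volterra T (A.applyL X))).trans
    (((N.incl'.comp N.incl).coeFn_compLpL X).sub (coeFn_volterra (A.applyL X))))
  have hind := indicatorConstLp_coeFn (p := 2) (μ := volume.restrict (Set.Ioc 0 T))
    (hs := measurableSet_Ioc (a := s) (b := T)) (hμs := measure_ne_top _ _) (c := N.incl' x)
  have h0 := (ae_restrict_iff' measurableSet_Ioc).1 hsol.1
  have h1 := (ae_restrict_iff' measurableSet_Ioc).1 hsol.2
  filter_upwards [hpt, hind, ae_restrict_of_ae h0, ae_restrict_of_ae h1,
    ae_restrict_mem measurableSet_Ioc] with t hp hi h0 h1 ht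
  rw [hp, hi, Pi.sub_apply, ContinuousLinearMap.comp_apply]
  by_cases hts : t ≤ s
  · rw [h0 ⟨ht.1, hts⟩, setIntegralL_Ioc_eq_zero hs.1 hts hA0,
      Set.indicator_of_notMem (fun h => absurd h.1 (not_lt.2 hts))]
    simp
  · have htm : t ∈ Set.Ioc s T := ⟨not_le.1 hts, ht.2⟩
    rw [h1 htm, Set.indicator_of_mem htm, add_zero,
      setIntegralL_Ioc_eq_of_ae_eq_zero le_rfl hs.1 hA0, add_sub_cancel_right]

/-- Fubini on the triangle `s < t`. -/
theorem integral_indicator_Ioc_swap {E : Type*} [NormedAddCommGroup E] [NormedSpace ℝ E]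
    {f : L2Time 0 T E} {B : Set ℝ} :
    ∫ s in Set.Ioc 0 T, ∫ t in B, (Set.Ioc s T).indicator (fun _ => f s) t
        ∂(volume.restrict (Set.Ioc 0 T))
      = setIntegralL (volume.restrict (Set.Ioc 0 T)) B (volterra T f) := by
  have hf : Integrable f (volume.restrict (Set.Ioc 0 T)) := (Lp.memLp f).integrable one_le_two
  have hmeas : MeasurableSet {p : ℝ × ℝ | p.2 ∈ Set.Ioc p.1 T} :=
    (measurableSet_lt measurable_fst measurable_snd).inter
      (measurableSet_le measurable_snd measurable_const)
  have hint : Integrable (Function.uncurry fun s t => (Set.Ioc s T).indicator (fun _ => f s) t)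
      ((volume.restrict (Set.Ioc 0 T)).prod ((volume.restrict (Set.Ioc 0 T)).restrict B)) := by
    have := (hf.comp_fst ((volume.restrict (Set.Ioc 0 T)).restrict B)).indicator hmeas
    refine this.congr (Eventually.of_forall fun p => ?_)
    by_cases hp : p.2 ∈ Set.Ioc p.1 T
    · rw [Set.indicator_of_mem (by exact hp)]
      simp only [Function.uncurry]
      rw [Set.indicator_of_mem hp]
    · rw [Set.indicator_of_notMem (by exact hp)]
      simp only [Function.uncurry]
      rw [Set.indicator_of_notMem hp]
  rw [integral_integral_swap hint, setIntegralL_apply]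
  refine integral_congr_ae (ae_restrict_of_ae ?_)
  filter_upwards [coeFn_volterra f, ae_restrict_mem measurableSet_Ioc] with t h1 ht
  have hind := integral_indicator (μ := volume.restrict (Set.Ioc 0 T))
    (measurableSet_Ioc (a := 0) (b := t)) (f := f)
  rw [h1, setIntegralL_apply, ← hind]
  refine integral_congr_ae ?_
  -- The point `s = t` is discarded: `t ∈ Ioc s T` excludes it, `s ∈ Ioc 0 t` does not.
  filter_upwards [ae_restrict_mem measurableSet_Ioc,
    ae_restrict_of_ae (compl_mem_ae_iff.2 (measure_singleton t))] with s hs hst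
  have hst : s ≠ t := hst
  by_cases hlt : s < t
  · rw [Set.indicator_of_mem (show t ∈ Set.Ioc s T from ⟨hlt, ht.2⟩),
      Set.indicator_of_mem (show s ∈ Set.Ioc 0 t from ⟨hs.1, hlt.le⟩)]
  · rw [Set.indicator_of_notMem (fun h => hlt h.1),
      Set.indicator_of_notMem (fun h => hlt (lt_of_le_of_ne h.2 hst))]

/-- The functions with values in `H` are dense among those with values in `V'`. -/
theorem denseRange_compLp_incl' (N : NormalTriple V H V') (T : ℝ) :
    DenseRange fun F : L2Time 0 T H => (N.incl'.compLp F : L2Time 0 T V') := by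
  let K : Submodule ℝ (L2Time 0 T V') :=
    (LinearMap.range (N.incl'.compLpL 2 (volume.restrict (Set.Ioc 0 T))).toLinearMap).topologicalClosure
  have hK : ∀ F : L2Time 0 T V', F ∈ K := fun F => by
    refine Lp.induction ENNReal.ofNat_ne_top (motive := fun F => F ∈ K) ?_ ?_ ?_ F
    · intro c s hs hμs
      obtain ⟨x', hx', hlim⟩ := mem_closure_iff_seq_limit.1 (N.incl'_dense c)
      choose x hx using hx'
      rw [Lp.simpleFunc.coe_indicatorConst]
      refine mem_closure_of_tendsto
        (f := fun n => indicatorConstLp 2 hs hμs.ne (N.incl' (x n))) (b := atTop) ?_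
        (Eventually.of_forall fun n => ?_)
      · simp only [hx]
        rw [tendsto_iff_norm_sub_tendsto_zero]
        have hb : ∀ n, ‖(indicatorConstLp 2 hs hμs.ne (x' n) : L2Time 0 T V')
            - indicatorConstLp 2 hs hμs.ne c‖
            ≤ ‖x' n - c‖ * (volume.restrict (Set.Ioc 0 T)).real s ^ (1 / (2 : ℝ≥0∞).toReal) :=
          fun n => by
            rw [indicatorConstLp_sub]
            exact norm_indicatorConstLp_le
        refine squeeze_zero (fun _ => norm_nonneg _) hb ?_
        simpa using (tendsto_iff_norm_sub_tendsto_zero.1 hlim).mul_const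
          ((volume.restrict (Set.Ioc 0 T)).real s ^ (1 / (2 : ℝ≥0∞).toReal))
      · refine ⟨indicatorConstLp 2 hs hμs.ne (x n), Lp.ext ?_⟩
        filter_upwards [N.incl'.coeFn_compLpL (p := 2) (μ := volume.restrict (Set.Ioc 0 T))
            (indicatorConstLp 2 hs hμs.ne (x n)),
          indicatorConstLp_coeFn (p := 2) (hs := hs) (hμs := hμs.ne) (c := x n),
          indicatorConstLp_coeFn (p := 2) (hs := hs) (hμs := hμs.ne) (c := N.incl' (x n))]
          with t h1 h2 h3
        refine h1.trans ?_
        rw [h2, h3]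
        by_cases hts : t ∈ s <;> simp [hts]
    · intro f g hf hg _ hfK hgK
      exact K.add_mem hfK hgK
    · exact Submodule.isClosed_topologicalClosure _
  intro F
  have := hK F
  rw [← SetLike.mem_coe, Submodule.topologicalClosure_coe] at this
  convert! this using 1

variable [CompleteSpace V] [CompleteSpace V']

/-- Duhamel's formula. -/
theorem ae_eq_integral_evolutionFamily (hT : 0 < T)
    (hS : ∀ s ∈ Set.Ico 0 T, ∀ x F X, IsSolutionFrom N A s x F X ↔ X = S s (x, F))
    (hC0 : 0 ≤ C) (hSC : ∀ s x F, ‖S s (x, F)‖ ≤ C * (‖x‖ + ‖F‖)) (F : L2Time 0 T H) :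
    ∀ᵐ t ∂(volume.restrict (Set.Ioc 0 T)),
      N.incl' (N.incl (S 0 (0, N.incl'.compLp F) t))
        = ∫ s in (0 : ℝ)..t, evolutionFamily N A t s (F s) := by
  obtain ⟨D, hD⟩ := exists_operatorFamily_solutionOperator hS hC0 hSC
  set μ : Measure ℝ := volume.restrict (Set.Ioc 0 T) with hμ
  have hg : Integrable (fun s => D.op s (F s)) μ := (D.memLp_apply F).integrable one_le_two
  -- The candidate superposes the solutions started at time `s` from `F s`, as a Bochner integral in
  -- `L₂((0, T); V)`. It is shown to solve the equation with forcing `f`, so that it equals `S 0 (0,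
  -- f)`.
  set G : L2Time 0 T V := ∫ s, D.op s (F s) ∂μ with hG
  set f : L2Time 0 T V' := N.incl'.compLp F with hf
  have hfae : f =ᵐ[μ] fun s => N.incl' (F s) := N.incl'.coeFn_compLp F
  have hmem : ∀ᵐ s ∂μ, s ∈ Set.Ico 0 T := by
    filter_upwards [ae_restrict_mem measurableSet_Ioc,
      ae_restrict_of_ae (compl_mem_ae_iff.2 (measure_singleton T))] with s hs hsT
    exact ⟨hs.1.le, lt_of_le_of_ne hs.2 hsT⟩
  set L : L2Time 0 T V →L[ℝ] L2Time 0 T V' :=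
    (N.incl'.comp N.incl).compLpL 2 μ - (volterra T).comp A.applyL with hL
  have hLG : L G = volterra T f := by
    have hint : ∀ w : L2Time 0 T V', Integrable w μ := fun w =>
      (Lp.memLp w).integrable one_le_two
    -- Pointwise evaluation in `t` is not continuous on `L₂`, so the identity is tested by integrals
    -- over sets `B`, which commute with the Bochner integral.
    refine Lp.ext (Lp.ae_eq_of_forall_setIntegral_eq _ _ two_ne_zero ENNReal.ofNat_ne_top
      (fun _ _ _ => (hint _).integrableOn) (fun _ _ _ => (hint _).integrableOn)
      fun B hB _ => ?_)
    rw [← setIntegralL_apply, ← setIntegralL_apply, hG, ← ContinuousLinearMap.comp_apply,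
      ← ContinuousLinearMap.integral_comp_comm _ hg, ← integral_indicator_Ioc_swap]
    refine integral_congr_ae ?_
    filter_upwards [hmem, hfae] with s hs hfs
    rw [ContinuousLinearMap.comp_apply, hD, hL, sub_apply,
      ContinuousLinearMap.comp_apply, compLpL_sub_volterra_solutionOperator hS hs, hfs]
    exact integral_congr_ae (ae_restrict_of_ae indicatorConstLp_coeFn)
  have hGeq : ∀ᵐ t ∂μ, N.incl' (N.incl (G t))
      = setIntegralL μ (Set.Ioc 0 t) (A.applyL G + f) := by
    have h1 : (N.incl'.comp N.incl).compLpL 2 μ G = volterra T (A.applyL G + f) := by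
      rw [map_add, ← hLG, hL, sub_apply, ContinuousLinearMap.comp_apply]
      abel
    filter_upwards [(N.incl'.comp N.incl).coeFn_compLpL (p := 2) (μ := μ) G,
      coeFn_volterra (A.applyL G + f)] with t h2 h3
    rw [← h3, ← h1, h2, ContinuousLinearMap.comp_apply]
  have hGS : G = S 0 (0, f) := by
    refine (hS 0 ⟨le_rfl, hT⟩ _ _ _).1 ⟨by simp [Filter.EventuallyEq], ?_⟩
    filter_upwards [hGeq] with t ht
    rw [ht, map_zero, zero_add]
  rw [← hGS]
  filter_upwards [hGeq, ae_restrict_mem measurableSet_Ioc] with t ht htm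
  -- Solutions started after `t` vanish on `(0, t]`, so only `s ≤ t` contributes.
  have hJ : setIntegralL μ (Set.Ioc 0 t) (A.applyL G) = ∫ s in Set.Ioc 0 t,
      setIntegralL μ (Set.Ioc 0 t) (A.applyL (D.op s (F s))) ∂μ := by
    have hind := integral_indicator (μ := μ) (measurableSet_Ioc (a := 0) (b := t))
      (f := fun s => setIntegralL μ (Set.Ioc 0 t) (A.applyL (D.op s (F s))))
    rw [← hind, hG, ← ContinuousLinearMap.comp_apply, ← ContinuousLinearMap.integral_comp_comm _ hg]
    refine integral_congr_ae ?_
    filter_upwards [hmem, ae_restrict_mem measurableSet_Ioc] with s hs hs0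
    by_cases hst : s ∈ Set.Ioc 0 t
    · rw [Set.indicator_of_mem hst]
      rfl
    · have hts : t ≤ s := by
        by_contra hlt
        exact hst ⟨hs0.1, (not_le.1 hlt).le⟩
      rw [Set.indicator_of_notMem hst, ContinuousLinearMap.comp_apply, hD]
      exact setIntegralL_Ioc_eq_zero hs.1 hts
        (applyL_ae_eq_zero hs.2.le ((hS s hs _ _ _).2 rfl).1)
  have hint1 : Integrable (fun s => setIntegralL μ (Set.Ioc 0 t) (A.applyL (D.op s (F s)))) μ :=
    ((setIntegralL μ (Set.Ioc 0 t)).comp A.applyL).integrable_comp hg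
  have hint2 : Integrable f μ := (Lp.memLp f).integrable one_le_two
  have hrestr : (volume : Measure ℝ).restrict (Set.Ioc 0 t) = μ.restrict (Set.Ioc 0 t) := by
    rw [hμ, Measure.restrict_restrict measurableSet_Ioc,
      Set.inter_eq_self_of_subset_left (Set.Ioc_subset_Ioc_right htm.2)]
  rw [ht, map_add, hJ, setIntegralL_apply, ← integral_add hint1.integrableOn hint2.integrableOn,
    intervalIntegral.integral_of_le htm.1.le, hrestr]
  refine integral_congr_ae ?_
  filter_upwards [ae_restrict_of_ae hmem, ae_restrict_of_ae hfae, ae_restrict_mem measurableSet_Ioc,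
    ae_restrict_of_ae (ae_restrict_of_ae (compl_mem_ae_iff.2 (measure_singleton t)))]
    with s hs hfs hst hne
  rw [evolutionFamily_eq hS hs ⟨lt_of_le_of_ne hst.2 hne, htm.2⟩, hfs, hD, add_comm]

/-- By Duhamel's formula and injectivity of the embeddings, every approximating sequence is the
image under `S 0` of its forcing, and continuity of `S 0` fixes the limit. Density of the `H`-valued
functions supplies such a sequence for every `F`. -/
theorem isEvolutionIntegral_iff (hT : 0 < T)
    (hS : ∀ s ∈ Set.Ico 0 T, ∀ x F X, IsSolutionFrom N A s x F X ↔ X = S s (x, F))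
    (hC0 : 0 ≤ C) (hSC : ∀ s x F, ‖S s (x, F)‖ ≤ C * (‖x‖ + ‖F‖))
    (F : L2Time 0 T V') (G : L2Time 0 T V) :
    IsEvolutionIntegral N A F G ↔ G = S 0 (0, F) := by
  have hduh := ae_eq_integral_evolutionFamily hT hS hC0 hSC
  have hcont : Continuous fun F : L2Time 0 T V' => S 0 (0, F) := by fun_prop
  constructor
  · rintro ⟨Fn, Gn, h1, h2, h3⟩
    have hGn : ∀ n, Gn n = S 0 (0, N.incl'.compLp (Fn n)) := fun n => by
      refine Lp.ext ?_
      filter_upwards [h1 n, hduh (Fn n)] with t h4 h5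
      exact N.incl_injective (N.incl'_injective (h4.trans h5.symm))
    obtain rfl : Gn = fun n => S 0 (0, N.incl'.compLp (Fn n)) := funext hGn
    exact tendsto_nhds_unique h3 ((hcont.tendsto F).comp h2)
  · rintro rfl
    obtain ⟨F', hF', hlim⟩ := mem_closure_iff_seq_limit.1 (denseRange_compLp_incl' N T F)
    choose Fn hFn using hF'
    have hlim' : Tendsto (fun n => N.incl'.compLp (Fn n)) atTop (𝓝 F) := by
      simpa only [hFn] using hlim
    exact ⟨Fn, fun n => S 0 (0, N.incl'.compLp (Fn n)), fun n => hduh (Fn n), hlim',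
      (hcont.tendsto F).comp hlim'⟩

end Duhamel

/-! ### The propagator and the Wick recursion. -/

section StochasticEquation

variable {V H V' U Ω ι : Type*} [NormedAddCommGroup V] [InnerProductSpace ℝ V]
  [NormedAddCommGroup H] [InnerProductSpace ℝ H]
  [NormedAddCommGroup V'] [InnerProductSpace ℝ V']
  [NormedAddCommGroup U] [InnerProductSpace ℝ U] [MeasurableSpace Ω] {T : ℝ}
  {N : NormalTriple V H V'} {A : OperatorFamily T V V'} {M : ι → OperatorFamily T V V'}
  {S : ℝ → (H × L2Time 0 T V') →L[ℝ] L2Time 0 T V}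

theorem inner_hilbertBasis_finsuppSum (b : HilbertBasis ι ℝ U) (z : ι →₀ ℝ) (k : ι) :
    inner ℝ (b k) (z.sum fun k c => c • b k) = z k :=
  b.orthonormal.inner_right_finsupp z k

/-- The propagator: the coefficients of a solution of the stochastic equation solve a lower
triangular system of deterministic equations. -/
theorem IsStochSolution.coeff_eq [CompleteSpace V] {P : Measure Ω} {W : U → Ω → ℝ}
    (hW : IsWhiteNoise P W) {b : HilbertBasis ι ℝ U} (hT : 0 < T)
    (hS : ∀ s ∈ Set.Ico 0 T, ∀ x F X, IsSolutionFrom N A s x F X ↔ X = S s (x, F))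
    {u₀ : H} {f : L2Time 0 T V'} {u : ChaosSeries ι (L2Time 0 T V)}
    (hu : IsStochSolution P b W N A M u₀ f u) {α : ι →₀ ℕ} (hα : α ≠ 0) :
    u α = ∑ k ∈ α.support,
      √(α k : ℝ) • S 0 (0, (M k).apply (u (α - Finsupp.single k 1))) := by
  classical
  obtain ⟨q, r, hq, hmem, hsol⟩ := hu
  obtain ⟨ε, hε, hεz⟩ := exists_pos_forall_memChaosDual hq r α.support
  have key := coeff_eq_of_forall_hasSum (c := fun β => (√(multiFactorial β))⁻¹ • u β)
    (x := S 0 (u₀, f))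
    (B := fun k => ((S 0).comp (ContinuousLinearMap.inr ℝ H (L2Time 0 T V'))).comp (M k).applyL)
    (J := α.support) hε (fun z hz hzε => ?_) subset_rfl
  -- Undoing the normalisation `c_β = u_β / √β!` leaves the factor `√(α! / (α - ε_k)!) = √α_k`.
  · rw [monomialSeries, if_neg hα, zero_add, inv_smul_eq_iff₀
      (Real.sqrt_pos.2 (multiFactorial_pos α)).ne', Finset.smul_sum] at key
    rw [key]
    refine Finset.sum_congr rfl fun k hk => ?_
    rw [map_smul, smul_smul]
    refine congrArg₂ (· • ·) ?_ rfl
    have hadd : α - Finsupp.single k 1 + Finsupp.single k 1 = α :=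
      tsub_add_cancel_of_le (Finsupp.single_le_iff.2
        (Nat.one_le_iff_ne_zero.2 (Finsupp.mem_support_iff.1 hk)))
    have h2 := multiFactorial_add_single (α - Finsupp.single k 1) k
    have h3 : (((α - Finsupp.single k 1 : ι →₀ ℕ) k : ℕ) : ℝ) + 1 = α k := by
      rw [Finsupp.tsub_apply, Finsupp.single_eq_same]
      exact_mod_cast Nat.succ_pred_eq_of_ne_zero (Finsupp.mem_support_iff.1 hk)
    rw [hadd, h3] at h2
    rw [h2, Real.sqrt_mul (by positivity), mul_assoc, mul_inv_cancel₀
      (Real.sqrt_pos.2 (multiFactorial_pos _)).ne', mul_one]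
  -- Because `h` has finitely many non-zero coordinates, both the smallness condition and the series
  -- over `k` reduce to finite sums.
  · obtain ⟨hlt, hdual⟩ := hεz z hz hzε
    set h : U := z.sum fun k c => c • b k with hh
    have hinner : ∀ k, inner ℝ (b k) h = z k := inner_hilbertBasis_finsuppSum b z
    have hz0 : ∀ k ∉ α.support, z k = 0 := fun k hk => by
      by_contra hne
      exact hk (hz (Finsupp.mem_support_iff.2 hne))
    have hζ : chaosCoeff P b W (stochExp W h) = fun α => α.prod fun k a => z k ^ a / √(a ! : ℝ) :=
      funext fun β => hW.chaosCoeff_stochExp b z β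
    have hsmall : SufficientlySmall b q h := by
      have hzero : ∀ k ∉ α.support, (q k ^ (1 : ℝ) * inner ℝ (b k) h) ^ 2 = 0 := fun k hk => by
        rw [hinner, hz0 k hk]
        simp
      refine ⟨1, one_pos, summable_of_ne_finset_zero hzero, ?_⟩
      rw [tsum_eq_sum hzero]
      simpa only [hinner] using hlt
    have hdual' : MemChaosDual q r (chaosCoeff P b W (stochExp W h)) := by
      rw [hζ]; exact hdual
    obtain ⟨G, hG, hdet⟩ := hsol h hsmall hdual'
    set Y := chaosPairing u (chaosCoeff P b W (stochExp W h)) with hY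
    refine ⟨Y, ?_, ?_⟩
    · have hsum := (summable_smul_of_memChaos hq hmem hdual').hasSum
      refine hsum.congr_fun fun β => ?_
      rw [hζ]
      dsimp only
      rw [prod_pow_div_sqrt, smul_smul]
    · have hG' : G = ∑ k ∈ α.support, z k • (M k).applyL Y := by
        refine hG.unique ?_
        have := hasSum_sum_of_ne_finset_zero (s := α.support)
          (f := fun k => (inner ℝ (b k) h : ℝ) • (M k).apply Y) (L := .unconditional ι)
          fun k hk => by rw [hinner, hz0 k hk, zero_smul]
        simpa only [hinner, (M _).applyL_apply] using this
      have hYS := (hS 0 ⟨le_rfl, hT⟩ _ _ _).1 (isSolutionFrom_zero_iff.2 hdet)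
      have hsplit : ((u₀, f + G) : H × L2Time 0 T V') = (u₀, f) + ContinuousLinearMap.inr ℝ H _ G := by
        simp
      rw [hsplit, map_add, hG', map_sum, map_sum] at hYS
      simpa only [map_smul] using! hYS

theorem weightPow_one_add_single {q : ι → ℝ} (γ : ι →₀ ℕ) (k : ι) :
    weightPow q 1 (γ + Finsupp.single k 1) = q k * weightPow q 1 γ := by
  classical
  simp only [weightPow, one_mul, Real.rpow_natCast]
  rw [Finsupp.prod_add_index' (by simp) (fun _ _ _ => pow_add _ _ _)]
  simp [mul_comm]

/-- The weighted chaos parts of a family satisfying the propagator satisfy the Wick recursion. -/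
theorem weightedChaosPart_succ_eq {R : L2Time 0 T V' →L[ℝ] L2Time 0 T V} {q : ι → ℝ}
    {u : ChaosSeries ι (L2Time 0 T V)}
    (hu : ∀ α : ι →₀ ℕ, α ≠ 0 →
      u α = ∑ k ∈ α.support, √(α k : ℝ) • R ((M k).apply (u (α - Finsupp.single k 1))))
    (n : ℕ) (α : ι →₀ ℕ) :
    weightedChaosPart q (n + 1) u α
      = R (skorokhod (fun k β => q k • (M k).apply (weightedChaosPart q n u β)) α) := by
  have hk : ∀ k ∈ α.support, α - Finsupp.single k 1 + Finsupp.single k 1 = α := fun k hk =>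
    tsub_add_cancel_of_le (Finsupp.single_le_iff.2
      (Nat.one_le_iff_ne_zero.2 (Finsupp.mem_support_iff.1 hk)))
  have hdeg : ∀ k ∈ α.support, (α - Finsupp.single k 1).degree + 1 = α.degree := fun k hks => by
    conv_rhs => rw [← hk k hks]
    simp
  rw [skorokhod_apply, map_sum, weightedChaosPart]
  split_ifs with hα
  · rw [hu α (by rintro rfl; simp at hα), Finset.smul_sum]
    refine Finset.sum_congr rfl fun k hks => ?_
    have hn : (α - Finsupp.single k 1).degree = n := by
      have := hdeg k hks
      omega
    -- One factor `q_k` of `q^α` goes to the operator `q_k M_k`; the others form the weight of the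
    -- previous chaos part.
    have hw := weightPow_one_add_single (q := q) (α - Finsupp.single k 1) k
    rw [hk k hks] at hw
    rw [weightedChaosPart, if_pos hn, ← (M k).applyL_apply, ← (M k).applyL_apply, map_smul, map_smul,
      map_smul, map_smul, hw, smul_smul, smul_smul, smul_smul]
    congr 1
    ring
  · refine (Finset.sum_eq_zero fun k hks => ?_).symm
    have hn : (α - Finsupp.single k 1).degree ≠ n := fun h => by
      have := hdeg k hks
      omega
    rw [weightedChaosPart, if_neg hn, ← (M k).applyL_apply, map_zero, smul_zero, smul_zero, map_zero]

end StochasticEquation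

end SkorokhodEvolution

theorem corollary4p1
    {V H V' U Ω : Type*}
    [NormedAddCommGroup V] [InnerProductSpace ℝ V] [CompleteSpace V]
    [NormedAddCommGroup H] [InnerProductSpace ℝ H] [CompleteSpace H]
    [NormedAddCommGroup V'] [InnerProductSpace ℝ V'] [CompleteSpace V']
    [NormedAddCommGroup U] [InnerProductSpace ℝ U] [CompleteSpace U]
    [MeasurableSpace Ω] (P : Measure Ω) [IsProbabilityMeasure P]
    (W : U → Ω → ℝ) (hW : IsWhiteNoise P W)
    (I : Set ℕ+) (b : HilbertBasis I ℝ U)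
    (N : NormalTriple V H V') (T : ℝ) (hT : 0 < T)
    (A : OperatorFamily T V V') (M : I → OperatorFamily T V V')
    (hA : WellPosed N A)
    (C : I → ℝ) (hC : ∀ k, 0 ≤ C k)
    (hM : ∀ (k : I) (v G : L2Time 0 T V),
      IsEvolutionIntegral N A ((M k).apply v) G → ‖G‖ ^ 2 ≤ C k ^ 2 * ‖v‖ ^ 2)
    (q : I → ℝ) (hq : ∀ k : I, q k = 2 * ((k : ℕ+) : ℝ) * (1 + C k))
    (u₀ : H) (f : L2Time 0 T V')
    (u : ChaosSeries I (L2Time 0 T V)) (hu : IsStochSolution P b W N A M u₀ f u) :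
    (∃! 𝒰 : ℕ → ChaosSeries I (L2Time 0 T V), IsWickIteration N A M q (u 0) 𝒰) ∧
    ∀ 𝒰 : ℕ → ChaosSeries I (L2Time 0 T V), IsWickIteration N A M q (u 0) 𝒰 →
      (∀ n, weightedChaosPart q n u = 𝒰 n) ∧
      ∃ (q' : I → ℝ) (r' : ℝ), IsWeightSequence q' ∧ ∀ n, MemChaos q' r' (𝒰 n) := by
  obtain ⟨S, K, hK, hS, hSK⟩ := hA.exists_solutionOperator
  have hiff := isEvolutionIntegral_iff hT hS hK hSK
  have hq1 : IsWeightSequence q := fun k => by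
    have h1 : (1 : ℝ) ≤ ((k : ℕ+) : ℝ) := Nat.one_le_cast.2 (k : ℕ+).pos
    rw [hq]
    nlinarith [hC k]
  have hzero : weightedChaosPart q 0 u = monomialSeries 0 (u 0) := by
    funext α
    by_cases hα : α = 0
    · simp [weightedChaosPart, monomialSeries, weightPow, hα]
    · simp [weightedChaosPart, monomialSeries, hα, Finsupp.degree_eq_zero_iff]
  have hiter : IsWickIteration N A M q (u 0) fun n => weightedChaosPart q n u :=
    ⟨hzero, fun n α => (hiff _ _).2 (weightedChaosPart_succ_eq
      (R := (S 0).comp (ContinuousLinearMap.inr ℝ H (L2Time 0 T V')))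
      (fun β hβ => hu.coeff_eq hW hT hS hβ) n α)⟩
  have huniq : ∀ 𝒰 : ℕ → ChaosSeries I (L2Time 0 T V), IsWickIteration N A M q (u 0) 𝒰 →
      ∀ n, weightedChaosPart q n u = 𝒰 n := by
    intro 𝒰 h𝒰 n
    induction n with
    | zero => rw [h𝒰.1, hzero]
    | succ n ih =>
      funext α
      rw [(hiff _ _).1 (h𝒰.2 n α), ← ih]
      exact (hiff _ _).1 (hiter.2 n α)
  refine ⟨⟨_, hiter, fun 𝒰 h𝒰 => funext fun n => (huniq 𝒰 h𝒰 n).symm⟩, fun 𝒰 h𝒰 => ⟨huniq 𝒰 h𝒰, ?_⟩⟩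
  obtain ⟨p, r, hp, hmem, -⟩ := hu
  -- The factor `q` pays for `q^α` and `p^{|r|}` dominates the weights of `u`; neither depends on
  -- `n`.
  refine ⟨fun k => q k * p k ^ |r|, -1, fun k => ?_, fun n => ?_⟩
  · exact one_le_mul_of_one_le_of_one_le (hq1 k) (Real.one_le_rpow (hp k) (abs_nonneg r))
  · rw [← huniq 𝒰 h𝒰 n]
    exact hmem.weightedChaosPart hp hq1 n
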